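/- Let $G=(I\sqcup J,E,<)$ be a finite bipartite graph in which every vertex $v$ has a linear order $<_v$ on the set $\delta(v)$ of its incident edges ($e<_v e'$ means that $v$ prefers $e$ to $e'$). A matching $M\subseteq E$ is stable if there is no edge $mw\in E\setminus M$ such that each of $m,w$ is either uncovered by $M$ or incident to an edge of $M$ that it likes less than $mw$. For stable matchings $M,L$ write $M\preceq L$ if $e\le_m e'$ whenever $e\in M$ and $e'\in L$ share a vertex $m\in I$. Let $M_{\min}$ (resp. $M_{\max}$) be the stable matching that is best for $I$ and worst for $J$ (resp. best for $J$ and worst for $I$) among all stable matchings. Given a stable matching $M$, an edge $a=mw\in E\setminus M$ ($m\in I$, $w\in J$) is admissible if $M$ contains an edge $e$ at $m$ with $e<_m a$, and $w$ is either uncovered by $M$ or incident to an edge $e'\in M$ with $a<_w e'$. The $<_m$-first admissible edge at $m$ (if any) is active. The active graph $\Gamma(M)$ is formed by the edges of $M$ and the active edges; a rotation for $M$ is a cycle $C$ of $\Gamma(M)$ (identified with its edge set), and eliminating $C$ replaces $M$ by $M\triangle C$. A trace is a sequence of stable matchings $M_0=M_{\min},M_1,\dots,M_N=M_{\max}$ such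 that each $M_i$ is obtained from $M_{i-1}$ by eliminating one rotation $C_i$ for $M_{i-1}$. Let $\mathcal R_G$ be the set of rotations occurring on traces, and for $C,D\in\mathcal R_G$ write $C\lessdot D$ if $C$ occurs earlier than $D$ on every trace. For a stable matching $M$ let $\mathcal R_M$ be the set of rotations $\{C_1,\dots,C_i\}$ eliminated on a trace before reaching $M=M_i$. Then every stable matching lies on a trace; the set of rotations of a trace is $\mathcal R_G$ for every trace; and $\mathcal R_M$ does not depend on the trace through $M$. The set of stable matchings is a lattice under $\preceq$, $\lessdot$ is a strict partial order on $\mathcal R_G$, and the map $M\mapsto\mathcal R_M$ is a lattice isomorphism from the lattice of stable matchings onto the lattice (under inclusion, with union and intersection as operations) of ideals of $(\mathcal R_G,\lessdot)$, i.e. of subsets $S\subseteq\mathcal R_G$ such that $C\lessdot D$ and $D\in S$ imply $C\in S$. Consequently, the map sending $M$ to the set of maximal elements of $\mathcal R_M$ is a bijection from the set of stable matchings onto the set of antichains (sets of pairwise incomparable elements, including the empty one) of $(\mathcal R_G,\lessdot)$. -/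

import Mathlib

/-- A bipartite graph with parts `I` and `J`, edge set `E` (the pair `(m, w)` is the edge `mw`), in
which every vertex has a linear order on its incident edges. `ltI m w w'` reads `mw <_m mw'`, that
is, `m` prefers the edge `mw` to the edge `mw'`; `ltJ w m m'` reads `mw <_w m'w`. The values of
these relations on pairs that are not edges play no role. -/
structure PrefGraph (I J : Type*) where
  E : Set (I × J)
  ltI : I → J → J → Prop
  ltJ : J → I → I → Prop
  ltI_irrefl : ∀ m w, (m, w) ∈ E → ¬ ltI m w w
  ltI_trans : ∀ m w₁ w₂ w₃, (m, w₁) ∈ E → (m, w₂) ∈ E → (m, w₃) ∈ E →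
    ltI m w₁ w₂ → ltI m w₂ w₃ → ltI m w₁ w₃
  ltI_total : ∀ m w₁ w₂, (m, w₁) ∈ E → (m, w₂) ∈ E → w₁ = w₂ ∨ ltI m w₁ w₂ ∨ ltI m w₂ w₁
  ltJ_irrefl : ∀ w m, (m, w) ∈ E → ¬ ltJ w m m
  ltJ_trans : ∀ w m₁ m₂ m₃, (m₁, w) ∈ E → (m₂, w) ∈ E → (m₃, w) ∈ E →
    ltJ w m₁ m₂ → ltJ w m₂ m₃ → ltJ w m₁ m₃
  ltJ_total : ∀ w m₁ m₂, (m₁, w) ∈ E → (m₂, w) ∈ E → m₁ = m₂ ∨ ltJ w m₁ m₂ ∨ ltJ w m₂ m₁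

namespace PrefGraph

variable {I J : Type*} (G : PrefGraph I J)

/-- A matching: a set of edges no two of which share a vertex. -/
def IsMatching (M : Set (I × J)) : Prop :=
  M ⊆ G.E ∧ ∀ e ∈ M, ∀ f ∈ M, (e.1 = f.1 ∨ e.2 = f.2) → e = f

/-- The edge `mw ∈ E - M` blocks `M`: each of `m`, `w` is uncovered by `M` or is matched by an edge
less preferred than `mw`. -/
def Blocks (M : Set (I × J)) (m : I) (w : J) : Prop :=
  (m, w) ∈ G.E ∧ (m, w) ∉ M ∧
    (∀ w', (m, w') ∈ M → G.ltI m w w') ∧ (∀ m', (m', w) ∈ M → G.ltJ w m m')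

/-- A stable matching: a matching without blocking edges. -/
structure StableMatching where
  edges : Set (I × J)
  isMatching : G.IsMatching edges
  stable : ∀ m w, ¬ G.Blocks edges m w

variable {G}

/-- `M ⪯ L`: at every common vertex `m ∈ I`, the edge of `M` is at least as good for `m` as the
edge of `L`. -/
def StableMatching.Prec (M L : G.StableMatching) : Prop :=
  ∀ m w w', (m, w) ∈ M.edges → (m, w') ∈ L.edges → w = w' ∨ G.ltI m w w'

/-- At every common vertex `w ∈ J`, the edge of `M` is at least as good for `w` as the edge
of `L`. -/
def StableMatching.BetterJ (M L : G.StableMatching) : Prop :=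
  ∀ w m m', (m, w) ∈ M.edges → (m', w) ∈ L.edges → m = m' ∨ G.ltJ w m m'

/-- `M = M_min`: the best stable matching for `I` and the worst for `J`. -/
def StableMatching.IsMmin (M : G.StableMatching) : Prop :=
  ∀ L : G.StableMatching, M.Prec L ∧ L.BetterJ M

/-- `M = M_max`: the best stable matching for `J` and the worst for `I`. -/
def StableMatching.IsMmax (M : G.StableMatching) : Prop :=
  ∀ L : G.StableMatching, M.BetterJ L ∧ L.Prec M

/-- The edge `mw ∈ E - M` is admissible for `M`: `m` is matched by an edge it prefers to `mw`, and
`w` is either uncovered or matched by an edge to which it prefers `mw`. -/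
def StableMatching.Admissible (M : G.StableMatching) (m : I) (w : J) : Prop :=
  (m, w) ∈ G.E ∧ (m, w) ∉ M.edges ∧ (∃ w', (m, w') ∈ M.edges ∧ G.ltI m w' w) ∧
    (∀ m', (m', w) ∈ M.edges → G.ltJ w m m')

/-- The edge `mw` is active: it is the first admissible edge at `m`. -/
def StableMatching.Active (M : G.StableMatching) (m : I) (w : J) : Prop :=
  M.Admissible m w ∧ ∀ w', M.Admissible m w' → w = w' ∨ G.ltI m w w'

/-- The active graph `Γ(M)`, with the edges of `M` and the active edges, on the vertex set
`I ⊔ J`. -/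
def StableMatching.activeGraph (M : G.StableMatching) : SimpleGraph (I ⊕ J) :=
  SimpleGraph.fromEdgeSet
    {e | ∃ m w, ((m, w) ∈ M.edges ∨ M.Active m w) ∧ e = s(Sum.inl m, Sum.inr w)}

/-- `C` is (the edge set of) a rotation for `M`: a cycle of the active graph `Γ(M)`. -/
def StableMatching.IsRotation (M : G.StableMatching) (C : Set (I × J)) : Prop :=
  ∃ (v : I ⊕ J) (p : M.activeGraph.Walk v v), p.IsCycle ∧
    C = {e : I × J | s(Sum.inl e.1, Sum.inr e.2) ∈ p.edges}

variable (G)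

/-- A trace: a sequence of stable matchings from `M_min` to `M_max` in which each member arises
from the previous one by exchanging the edges along one rotation. Here `rot i` leads from
`matching i` to `matching (i + 1)`. -/
structure Trace where
  len : ℕ
  matching : Fin (len + 1) → G.StableMatching
  rot : Fin len → Set (I × J)
  first : (matching 0).IsMmin
  last : (matching (Fin.last len)).IsMmax
  isRotation : ∀ i : Fin len, (matching i.castSucc).IsRotation (rot i)
  step : ∀ i : Fin len, (matching i.succ).edges = symmDiff (matching i.castSucc).edges (rot i)

/-- The set `R_G` of rotations occurring on traces, as a type. -/
structure Rotation where
  edges : Set (I × J)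
  occurs : ∃ (τ : G.Trace) (i : Fin τ.len), τ.rot i = edges

variable {G}

/-- `C ⋖ D`: on every trace the rotation `C` occurs earlier than `D`. -/
def Rotation.Precedes (C D : G.Rotation) : Prop :=
  ∀ τ : G.Trace, ∃ i j : Fin τ.len, i < j ∧ τ.rot i = C.edges ∧ τ.rot j = D.edges

/-- The set of the rotations used by the trace `τ` before its `i`-th matching. -/
def Trace.rotationsBefore (τ : G.Trace) (i : Fin (τ.len + 1)) : Set G.Rotation :=
  {C | ∃ j : Fin τ.len, j.castSucc < i ∧ τ.rot j = C.edges}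

/-- `R_M`: the rotations eliminated on a trace from `M_min` to `M`. -/
def StableMatching.rotations (M : G.StableMatching) : Set G.Rotation :=
  {C | ∃ (τ : G.Trace) (i : Fin (τ.len + 1)), τ.matching i = M ∧ C ∈ τ.rotationsBefore i}

end PrefGraph

/-! Preferences become ranks, and a stable matching becomes its vector `pos` of ranks at the
vertices of I. All stable matchings cover the same vertices, so `pos` is injective and ⪯ is the
pointwise order. Pointwise maxima and minima are again stable (`exists_sup`, `exists_inf`). All this
rests on `opposition`: the vertices of I better off in M and those of J better off in L are matched
with each other by both M and L.

A rotation for M moves a set S of vertices of I from their edges in M to their active edges. It is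
an indivisible move: in any stable matching, either no vertex of S is beyond its old position or all
of S have reached their new ones (`Step.exists_support`). So "L has passed C" (`Past`) makes sense
without reference to a trace. The crux is `Step.past_iff`: eliminating C adds C, and nothing else,
to the rotations passed. As M_min has passed none and M_max all, induction along a trace identifies
R_M with the rotations passed by M, whatever the trace.

By `prec_iff_past`, M ⪯ L means that L has passed all that M has: otherwise L admits a rotation
towards the join of M and L, which M has passed and L has not. The passed sets are closed under
union and intersection. Rotations are ordered by implication between being passed, which agrees with
⋖; a matching with fewest passed rotations among those past D realizes the principal ideal of D, and
joins realize all ideals. Finally, an ideal of a finite poset is determined by its maximal elements.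
-/

namespace PrefGraph

variable {I J : Type*} (G : PrefGraph I J)

/-! ### Ranks in place of preference orders. -/

/-- The rank of the edge `mw` in the order of `m`: the number of edges that `m` prefers to it. -/
noncomputable def rankI (m : I) (w : J) : ℕ := {w' | (m, w') ∈ G.E ∧ G.ltI m w' w}.ncard

/-- The rank of the edge `mw` in the order of `w`: the number of edges that `w` prefers to it. -/
noncomputable def rankJ (w : J) (m : I) : ℕ := {m' | (m', w) ∈ G.E ∧ G.ltJ w m' m}.ncard

variable {G}

theorem ltI_iff [Finite J] {m : I} {w w' : J} (h : (m, w) ∈ G.E) (h' : (m, w') ∈ G.E) :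
    G.ltI m w w' ↔ G.rankI m w < G.rankI m w' := by
  have key : ∀ w w', (m, w) ∈ G.E → (m, w') ∈ G.E → G.ltI m w w' →
      G.rankI m w < G.rankI m w' := fun w w' h h' hlt =>
    Set.ncard_lt_ncard ⟨fun x hx => ⟨hx.1, G.ltI_trans m x w w' hx.1 h h' hx.2 hlt⟩,
      fun hs => G.ltI_irrefl m w h (hs ⟨h, hlt⟩ : w ∈ {x | (m, x) ∈ G.E ∧ G.ltI m x w}).2⟩
      (Set.toFinite _)
  refine ⟨key w w' h h', fun hlt => ?_⟩
  rcases G.ltI_total m w w' h h' with rfl | h1 | h1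
  · exact absurd hlt (lt_irrefl _)
  · exact h1
  · exact absurd (key _ _ h' h h1) hlt.asymm

theorem ltJ_iff [Finite I] {w : J} {m m' : I} (h : (m, w) ∈ G.E) (h' : (m', w) ∈ G.E) :
    G.ltJ w m m' ↔ G.rankJ w m < G.rankJ w m' := by
  have key : ∀ m m', (m, w) ∈ G.E → (m', w) ∈ G.E → G.ltJ w m m' →
      G.rankJ w m < G.rankJ w m' := fun m m' h h' hlt =>
    Set.ncard_lt_ncard ⟨fun x hx => ⟨hx.1, G.ltJ_trans w x m m' hx.1 h h' hx.2 hlt⟩,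
      fun hs => G.ltJ_irrefl w m h (hs ⟨h, hlt⟩ : m ∈ {x | (x, w) ∈ G.E ∧ G.ltJ w x m}).2⟩
      (Set.toFinite _)
  refine ⟨key m m' h h', fun hlt => ?_⟩
  rcases G.ltJ_total w m m' h h' with rfl | h1 | h1
  · exact absurd hlt (lt_irrefl _)
  · exact h1
  · exact absurd (key _ _ h' h h1) hlt.asymm

theorem rankI_inj [Finite J] {m : I} {w w' : J} (h : (m, w) ∈ G.E) (h' : (m, w') ∈ G.E)
    (he : G.rankI m w = G.rankI m w') : w = w' := by
  rcases G.ltI_total m w w' h h' with h1 | h1 | h1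
  · exact h1
  · exact absurd ((ltI_iff h h').1 h1) he.not_lt
  · exact absurd ((ltI_iff h' h).1 h1) he.not_gt

theorem rankJ_inj [Finite I] {w : J} {m m' : I} (h : (m, w) ∈ G.E) (h' : (m', w) ∈ G.E)
    (he : G.rankJ w m = G.rankJ w m') : m = m' := by
  rcases G.ltJ_total w m m' h h' with h1 | h1 | h1
  · exact h1
  · exact absurd ((ltJ_iff h h').1 h1) he.not_lt
  · exact absurd ((ltJ_iff h' h).1 h1) he.not_gt

/-! ### Stability as domination, existence, and opposition of interests. -/

namespace StableMatching

theorem mem_E (M : G.StableMatching) {m : I} {w : J} (h : (m, w) ∈ M.edges) : (m, w) ∈ G.E :=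
  M.isMatching.1 h

theorem eq_of_mem_left (M : G.StableMatching) {m : I} {w w' : J} (h : (m, w) ∈ M.edges)
    (h' : (m, w') ∈ M.edges) : w = w' :=
  congrArg Prod.snd (M.isMatching.2 _ h _ h' (Or.inl rfl))

theorem eq_of_mem_right (M : G.StableMatching) {m m' : I} {w : J} (h : (m, w) ∈ M.edges)
    (h' : (m', w) ∈ M.edges) : m = m' :=
  congrArg Prod.fst (M.isMatching.2 _ h _ h' (Or.inr rfl))

theorem edges_injective : Function.Injective (StableMatching.edges (G := G)) := by
  rintro ⟨a, _, _⟩ ⟨b, _, _⟩ h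
  cases h
  rfl

instance [Finite I] [Finite J] : Finite G.StableMatching :=
  Finite.of_injective _ edges_injective

variable [Finite I] [Finite J]

/-- Stability in terms of ranks: an edge of the graph is dominated at one of its ends. -/
theorem dominated (M : G.StableMatching) {m : I} {w : J} (h : (m, w) ∈ G.E) :
    (∃ w', (m, w') ∈ M.edges ∧ G.rankI m w' ≤ G.rankI m w) ∨
      (∃ m', (m', w) ∈ M.edges ∧ G.rankJ w m' ≤ G.rankJ w m) := by
  by_contra! hc
  refine M.stable m w ⟨h, fun hm => (hc.1 w hm).false, fun w' hw' => ?_, fun m' hm' => ?_⟩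
  · exact (ltI_iff h (M.mem_E hw')).2 (hc.1 w' hw')
  · exact (ltJ_iff h (M.mem_E hm')).2 (hc.2 m' hm')

/-- A matching that dominates every edge is stable. -/
def ofDominated (M : Set (I × J)) (hE : M ⊆ G.E)
    (hl : ∀ m w w', (m, w) ∈ M → (m, w') ∈ M → w = w')
    (hr : ∀ m m' w, (m, w) ∈ M → (m', w) ∈ M → m = m')
    (hd : ∀ m w, (m, w) ∈ G.E → (∃ w', (m, w') ∈ M ∧ G.rankI m w' ≤ G.rankI m w) ∨
      (∃ m', (m', w) ∈ M ∧ G.rankJ w m' ≤ G.rankJ w m)) : G.StableMatching where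
  edges := M
  isMatching := by
    refine ⟨hE, ?_⟩
    rintro ⟨m, w⟩ h ⟨m', w'⟩ h' (he | he)
    · obtain rfl : m = m' := he
      rw [hl _ _ _ h h']
    · obtain rfl : w = w' := he
      rw [hr _ _ _ h h']
  stable := by
    rintro m w ⟨h, -, h1, h2⟩
    rcases hd m w h with ⟨w', hw', hle⟩ | ⟨m', hm', hle⟩
    · exact ((ltI_iff h (hE hw')).1 (h1 w' hw')).not_ge hle
    · exact ((ltJ_iff h (hE hm')).1 (h2 m' hm')).not_ge hle

/-- Stable matchings exist (Gale and Shapley), here from a fixed point of a monotone operator on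
the sets of edges. -/
theorem nonempty : Nonempty G.StableMatching := by
  -- `dI A` and `dJ A` collect the edges beaten by an edge of `A` at their end in I or in J. Taking
  -- the complement of either is antitone, so the composite `f` is monotone.
  let dI : Set (I × J) → Set (I × J) :=
    fun A => {e | ∃ w, (e.1, w) ∈ A ∧ G.rankI e.1 w < G.rankI e.1 e.2}
  let dJ : Set (I × J) → Set (I × J) :=
    fun A => {e | ∃ m, (m, e.2) ∈ A ∧ G.rankJ e.2 m < G.rankJ e.2 e.1}
  let f : Set (I × J) →o Set (I × J) :=
    ⟨fun A => G.E \ dJ (G.E \ dI A), by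
      rintro A A' h e ⟨he, hn⟩
      refine ⟨he, ?_⟩
      rintro ⟨m, ⟨hm, hm'⟩, hlt⟩
      refine hn ⟨m, ⟨hm, ?_⟩, hlt⟩
      rintro ⟨w, hw, hlt'⟩
      exact hm' ⟨w, h hw, hlt'⟩⟩
  obtain ⟨A, hA⟩ : ∃ A, G.E \ dJ (G.E \ dI A) = A := ⟨f.lfp, f.map_lfp⟩
  set B := G.E \ dI A with hB
  have hAE : A ⊆ G.E := hA ▸ Set.sdiff_subset
  have hBE : B ⊆ G.E := Set.sdiff_subset
  have mA : ∀ m w, (m, w) ∈ A → ∀ m', (m', w) ∈ B → G.rankJ w m ≤ G.rankJ w m' := by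
    intro m w h m' h'
    rw [← hA] at h
    by_contra! hlt
    exact h.2 ⟨m', h', hlt⟩
  have mB : ∀ m w, (m, w) ∈ B → ∀ w', (m, w') ∈ A → G.rankI m w ≤ G.rankI m w' := by
    intro m w h w' h'
    by_contra! hlt
    exact h.2 ⟨w', h', hlt⟩
  -- An edge of `A ∩ B` is the favourite in `A` of its end in I and the favourite in `B` of its end
  -- in J. An edge in `A` is dominated by the favourite of its end in I; one outside `A` is beaten
  -- at its other end by an edge of `B`.
  refine ⟨ofDominated (A ∩ B) (fun e he => hAE he.1) ?_ ?_ ?_⟩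
  · intro m w w' h h'
    exact rankI_inj (hAE h.1) (hAE h'.1) ((mB _ _ h.2 _ h'.1).antisymm (mB _ _ h'.2 _ h.1))
  · intro m m' w h h'
    exact rankJ_inj (hAE h.1) (hAE h'.1) ((mA _ _ h.1 _ h'.2).antisymm (mA _ _ h'.1 _ h.2))
  · intro m w h
    by_cases hwA : (m, w) ∈ A
    · left
      obtain ⟨w', hw', hmin⟩ := Set.exists_min_image {w | (m, w) ∈ A} (G.rankI m)
        (Set.toFinite _) ⟨w, hwA⟩
      refine ⟨w', ⟨hw', hAE hw', ?_⟩, hmin w hwA⟩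
      rintro ⟨w'', h'', hlt⟩
      exact (hmin w'' h'').not_gt hlt
    · right
      have hd : (m, w) ∈ dJ B := by
        by_contra hn
        exact hwA (hA ▸ ⟨h, hn⟩)
      obtain ⟨m0, hm0, hlt0⟩ := hd
      obtain ⟨m', hm', hmin⟩ := Set.exists_min_image {m | (m, w) ∈ B} (G.rankJ w)
        (Set.toFinite _) ⟨m0, hm0⟩
      refine ⟨m', ⟨?_, hm'⟩, (hmin m0 hm0).trans hlt0.le⟩
      rw [← hA]
      refine ⟨hBE hm', ?_⟩
      rintro ⟨m'', h'', hlt⟩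
      exact (hmin m'' h'').not_gt hlt

/-- The vertices of `I` that are better off in `M` than in `L` are matched, by `M` and by `L`, with
the vertices of `J` that are better off in `L` than in `M`. -/
theorem opposition (M L : G.StableMatching) :
    let A := {m | ∃ w, (m, w) ∈ M.edges ∧ ∀ w', (m, w') ∈ L.edges → G.rankI m w < G.rankI m w'}
    let B := {w | ∃ m, (m, w) ∈ L.edges ∧ ∀ m', (m', w) ∈ M.edges → G.rankJ w m < G.rankJ w m'}
    (∀ m ∈ A, ∃ w ∈ B, (m, w) ∈ M.edges) ∧ (∀ w ∈ B, ∃ m ∈ A, (m, w) ∈ L.edges) ∧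
      (∀ m ∈ A, ∃ w ∈ B, (m, w) ∈ L.edges) ∧ (∀ w ∈ B, ∃ m ∈ A, (m, w) ∈ M.edges) := by
  intro A B
  have h1 : ∀ m ∈ A, ∃ w ∈ B, (m, w) ∈ M.edges := by
    rintro m ⟨w, hw, hlt⟩
    refine ⟨w, ?_, hw⟩
    rcases L.dominated (M.mem_E hw) with ⟨w', hw', hle⟩ | ⟨m', hm', hle⟩
    · exact absurd (hlt w' hw') hle.not_gt
    · refine ⟨m', hm', fun m'' hm'' => ?_⟩
      obtain rfl := M.eq_of_mem_right hw hm''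
      refine lt_of_le_of_ne hle fun he => ?_
      obtain rfl := rankJ_inj (L.mem_E hm') (M.mem_E hw) he
      exact (hlt w hm').false
  have h2 : ∀ w ∈ B, ∃ m ∈ A, (m, w) ∈ L.edges := by
    rintro w ⟨m, hm, hlt⟩
    refine ⟨m, ?_, hm⟩
    rcases M.dominated (L.mem_E hm) with ⟨w', hw', hle⟩ | ⟨m', hm', hle⟩
    · refine ⟨w', hw', fun w'' hw'' => ?_⟩
      obtain rfl := L.eq_of_mem_left hm hw''
      refine lt_of_le_of_ne hle fun he => ?_
      obtain rfl := rankI_inj (M.mem_E hw') (L.mem_E hm) he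
      exact (hlt m hw').false
    · exact absurd (hlt m' hm') hle.not_gt
  -- `M` injects `A` into `B` and `L` injects `B` into `A`; by finiteness both injections are onto,
  -- which gives the two remaining claims.
  have h1' : ∀ m : A, ∃ w : B, (m.1, w.1) ∈ M.edges := fun m =>
    let ⟨w, hw, h⟩ := h1 m.1 m.2
    ⟨⟨w, hw⟩, h⟩
  have h2' : ∀ w : B, ∃ m : A, (m.1, w.1) ∈ L.edges := fun w =>
    let ⟨m, hm, h⟩ := h2 w.1 w.2
    ⟨⟨m, hm⟩, h⟩
  choose α hα using h1'
  choose β hβ using h2'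
  have hαi : Function.Injective α := fun x y hxy =>
    Subtype.ext (M.eq_of_mem_right (hα x) (hxy ▸ hα y))
  have hβi : Function.Injective β := fun x y hxy =>
    Subtype.ext (L.eq_of_mem_left (hβ x) (hxy ▸ hβ y))
  have hβs : Function.Surjective β :=
    (Finite.surjective_of_injective (hβi.comp hαi)).of_comp
  have hαs : Function.Surjective α :=
    (Finite.surjective_of_injective (hαi.comp hβi)).of_comp
  refine ⟨h1, h2, fun m hm => ?_, fun w hw => ?_⟩
  · obtain ⟨w, hw⟩ := hβs ⟨m, hm⟩
    have := hβ w
    rw [hw] at this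
    exact ⟨w, w.2, this⟩
  · obtain ⟨m, hm⟩ := hαs ⟨w, hw⟩
    have := hα m
    rw [hm] at this
    exact ⟨m, m.2, this⟩

/-- All stable matchings cover the same vertices of `I`. -/
theorem covered_left (M L : G.StableMatching) {m : I} {w : J} (h : (m, w) ∈ M.edges) :
    ∃ w', (m, w') ∈ L.edges := by
  by_contra! hn
  -- A vertex uncovered by `L` counts vacuously as better off in `M`, yet such vertices are covered
  -- by `L`.
  obtain ⟨w', -, hw'⟩ := (opposition M L).2.2.1 m ⟨w, h, fun w' hw' => absurd hw' (hn w')⟩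
  exact hn w' hw'

/-- All stable matchings cover the same vertices of `J`. -/
theorem covered_right (M L : G.StableMatching) {m : I} {w : J} (h : (m, w) ∈ M.edges) :
    ∃ m', (m', w) ∈ L.edges := by
  by_contra! hn
  obtain ⟨m', -, hm'⟩ := (opposition L M).2.2.2 w ⟨m, h, fun m' hm' => absurd hm' (hn m')⟩
  exact hn m' hm'

/-- If `w` prefers its edge `mw` in `M` to its edge in `L`, then `m` prefers its edge in `L`. -/
theorem rankI_lt_of_rankJ_lt (M L : G.StableMatching) {m m' : I} {w w' : J}
    (h : (m, w) ∈ M.edges) (h' : (m', w) ∈ L.edges) (hlt : G.rankJ w m < G.rankJ w m')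
    (hw' : (m, w') ∈ L.edges) : G.rankI m w' < G.rankI m w := by
  obtain ⟨m1, ⟨w1, hw1, hl⟩, h1⟩ := (opposition L M).2.1 w
    ⟨m, h, fun x hx => by rwa [L.eq_of_mem_right hx h']⟩
  obtain rfl := M.eq_of_mem_right h h1
  obtain rfl := L.eq_of_mem_left hw' hw1
  exact hl w h

end StableMatching

end PrefGraph

/-! ### The lattice of stable matchings. -/

namespace PrefGraph

variable {I J : Type*} {G : PrefGraph I J}

namespace StableMatching

variable [Finite I] [Finite J]

/-- If `w` prefers its edge in `L` to its edge `mw` in `M`, then `m` prefers its edge in `M`. -/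
theorem rankI_lt_of_rankJ_gt (M L : G.StableMatching) {m m' : I} {w w' : J}
    (h : (m, w) ∈ M.edges) (h' : (m', w) ∈ L.edges) (hlt : G.rankJ w m' < G.rankJ w m)
    (hw' : (m, w') ∈ L.edges) : G.rankI m w < G.rankI m w' := by
  obtain ⟨m1, ⟨w1, hw1, hl⟩, h1⟩ := (opposition M L).2.2.2 w
    ⟨m', h', fun x hx => by rwa [M.eq_of_mem_right hx h]⟩
  obtain rfl := M.eq_of_mem_right h h1
  obtain rfl := M.eq_of_mem_left h hw1
  exact hl w' hw'

open Classical in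
/-- The rank at `m` of the edge of `M`, or `0` if there is no such edge. -/
noncomputable def pos (M : G.StableMatching) (m : I) : ℕ :=
  -- The value 0 is also the rank of a first choice, but no confusion arises: a vertex uncovered by
  -- one stable matching is uncovered by all.
  if h : ∃ w, (m, w) ∈ M.edges then G.rankI m h.choose else 0

omit [Finite I] [Finite J] in
theorem pos_eq (M : G.StableMatching) {m : I} {w : J} (h : (m, w) ∈ M.edges) :
    M.pos m = G.rankI m w := by
  have hex : ∃ w, (m, w) ∈ M.edges := ⟨w, h⟩
  rw [pos, dif_pos hex, M.eq_of_mem_left hex.choose_spec h]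

omit [Finite I] [Finite J] in
theorem pos_of_forall_notMem (M : G.StableMatching) {m : I} (h : ∀ w, (m, w) ∉ M.edges) :
    M.pos m = 0 := by
  rw [pos, dif_neg (by simpa using h)]

omit [Finite I] in
theorem eq_of_pos_eq (M L : G.StableMatching) {m : I} {w w' : J} (h : (m, w) ∈ M.edges)
    (h' : (m, w') ∈ L.edges) (he : M.pos m = L.pos m) : w = w' :=
  rankI_inj (M.mem_E h) (L.mem_E h') (by rw [← M.pos_eq h, he, L.pos_eq h'])

theorem pos_injective : Function.Injective (StableMatching.pos (G := G)) := by
  have key : ∀ M L : G.StableMatching, M.pos = L.pos → M.edges ⊆ L.edges := by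
    rintro M L h ⟨m, w⟩ hw
    obtain ⟨w', hw'⟩ := covered_left M L hw
    rwa [eq_of_pos_eq M L hw hw' (congrFun h m)]
  exact fun M L h => edges_injective ((key M L h).antisymm (key L M h.symm))

theorem prec_iff (M L : G.StableMatching) : M.Prec L ↔ ∀ m, M.pos m ≤ L.pos m := by
  constructor
  · intro h m
    by_cases hm : ∃ w, (m, w) ∈ M.edges
    · obtain ⟨w, hw⟩ := hm
      obtain ⟨w', hw'⟩ := covered_left M L hw
      rw [M.pos_eq hw, L.pos_eq hw']
      rcases h m w w' hw hw' with rfl | h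
      · exact le_rfl
      · exact ((ltI_iff (M.mem_E hw) (L.mem_E hw')).1 h).le
    · rw [M.pos_of_forall_notMem (by simpa using hm)]
      exact Nat.zero_le _
  · intro h m w w' hw hw'
    rcases (h m).eq_or_lt with h | h
    · exact Or.inl (eq_of_pos_eq M L hw hw' h)
    · refine Or.inr ((ltI_iff (M.mem_E hw) (L.mem_E hw')).2 ?_)
      rwa [M.pos_eq hw, L.pos_eq hw'] at h

/-- If some `w` preferred its edge in `M`, its partner there would prefer its edge in `L`, by
opposition. Hence optimality for I alone already gives the condition on J in `IsMmin` and `IsMmax`.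
-/
theorem betterJ_of_prec {M L : G.StableMatching} (h : M.Prec L) : L.BetterJ M := by
  intro w m m' hm hm'
  by_contra! hc
  have hlt : G.rankJ w m' < G.rankJ w m := by
    refine lt_of_le_of_ne (not_lt.1 fun hl => hc.2 ?_) fun he => hc.1 ?_
    · exact (ltJ_iff (L.mem_E hm) (M.mem_E hm')).2 hl
    · exact (rankJ_inj (M.mem_E hm') (L.mem_E hm) he).symm
  obtain ⟨w', hw'⟩ := covered_left M L hm'
  have h1 := rankI_lt_of_rankJ_lt M L hm' hm hlt hw'
  have h2 := (prec_iff M L).1 h m'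
  rw [M.pos_eq hm', L.pos_eq hw'] at h2
  exact h2.not_gt h1

/-- Every vertex of `I` can be given the worse of its edges in two stable matchings. -/
theorem exists_sup (M L : G.StableMatching) :
    ∃ N : G.StableMatching, ∀ m, N.pos m = max (M.pos m) (L.pos m) := by
  have better : ∀ (M L : G.StableMatching) m m' w, (m, w) ∈ M.edges → (m', w) ∈ L.edges →
      G.rankJ w m ≤ G.rankJ w m' → ∀ w', (m, w') ∈ L.edges → G.rankI m w' ≤ G.rankI m w := by
    intro M L m m' w h h' hle w' hw'
    rcases hle.eq_or_lt with he | hlt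
    · obtain rfl := rankJ_inj (M.mem_E h) (L.mem_E h') he
      rw [L.eq_of_mem_left hw' h']
    · exact (rankI_lt_of_rankJ_lt M L h h' hlt hw').le
  let N : Set (I × J) := {e | (e ∈ M.edges ∧ ∀ w', (e.1, w') ∈ L.edges →
    G.rankI e.1 w' ≤ G.rankI e.1 e.2) ∨ (e ∈ L.edges ∧ ∀ w', (e.1, w') ∈ M.edges →
    G.rankI e.1 w' ≤ G.rankI e.1 e.2)}
  -- Two distinct vertices cannot both receive `w` as their worse partner: whichever of them `w`
  -- likes less would, by opposition, prefer `w` to its other partner.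
  have hdisj : ∀ m m' w, (m, w) ∈ M.edges → (∀ w', (m, w') ∈ L.edges →
      G.rankI m w' ≤ G.rankI m w) → (m', w) ∈ L.edges → (∀ w', (m', w') ∈ M.edges →
      G.rankI m' w' ≤ G.rankI m' w) → m = m' := by
    intro m m' w h1 h2 h3 h4
    by_contra hne
    obtain ⟨w1, hw1⟩ := covered_left M L h1
    obtain ⟨w2, hw2⟩ := covered_left L M h3
    have l1 : G.rankI m w1 < G.rankI m w := lt_of_le_of_ne (h2 w1 hw1) fun he => by
      obtain rfl := rankI_inj (L.mem_E hw1) (M.mem_E h1) he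
      exact hne (L.eq_of_mem_right hw1 h3)
    have l2 : G.rankI m' w2 < G.rankI m' w := lt_of_le_of_ne (h4 w2 hw2) fun he => by
      obtain rfl := rankI_inj (M.mem_E hw2) (L.mem_E h3) he
      exact hne (M.eq_of_mem_right h1 hw2)
    rcases lt_trichotomy (G.rankJ w m) (G.rankJ w m') with hl | he | hl
    · exact l2.not_gt (rankI_lt_of_rankJ_gt L M h3 h1 hl hw2)
    · exact hne (rankJ_inj (M.mem_E h1) (L.mem_E h3) he)
    · exact l1.not_gt (rankI_lt_of_rankJ_gt M L h1 h3 hl hw1)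
  have hNE : N ⊆ G.E := fun e he => he.elim (fun h => M.mem_E h.1) fun h => L.mem_E h.1
  have hcov : ∀ m w1 w2, (m, w1) ∈ M.edges → (m, w2) ∈ L.edges →
      ∃ w', (m, w') ∈ N ∧ G.rankI m w' = max (G.rankI m w1) (G.rankI m w2) := by
    intro m w1 w2 h1 h2
    rcases le_total (G.rankI m w1) (G.rankI m w2) with hle | hle
    · exact ⟨w2, Or.inr ⟨h2, fun w' hw' => by rwa [M.eq_of_mem_left hw' h1]⟩,
        (max_eq_right hle).symm⟩
    · exact ⟨w1, Or.inl ⟨h1, fun w' hw' => by rwa [L.eq_of_mem_left hw' h2]⟩,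
        (max_eq_left hle).symm⟩
  -- Vertices of J get the better of their two edges. So an edge dominated in J by `M` or by `L`
  -- stays dominated, and otherwise both dominate it in I, where the worse edge suffices.
  have hdom : ∀ m1 m2 w, (m1, w) ∈ M.edges → (m2, w) ∈ L.edges →
      ∃ m', (m', w) ∈ N ∧ G.rankJ w m' ≤ G.rankJ w m1 ∧ G.rankJ w m' ≤ G.rankJ w m2 := by
    intro m1 m2 w h1 h2
    rcases le_total (G.rankJ w m1) (G.rankJ w m2) with hle | hle
    · exact ⟨m1, Or.inl ⟨h1, better M L m1 m2 w h1 h2 hle⟩, le_rfl, hle⟩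
    · exact ⟨m2, Or.inr ⟨h2, better L M m2 m1 w h2 h1 hle⟩, hle, le_rfl⟩
  refine ⟨ofDominated N hNE ?_ ?_ ?_, ?_⟩
  · rintro m w w' (⟨h, hl⟩ | ⟨h, hl⟩) (⟨h', hl'⟩ | ⟨h', hl'⟩)
    · exact M.eq_of_mem_left h h'
    · exact rankI_inj (M.mem_E h) (L.mem_E h') ((hl' w h).antisymm (hl w' h'))
    · exact rankI_inj (L.mem_E h) (M.mem_E h') ((hl' w h).antisymm (hl w' h'))
    · exact L.eq_of_mem_left h h'
  · rintro m m' w (⟨h, hl⟩ | ⟨h, hl⟩) (⟨h', hl'⟩ | ⟨h', hl'⟩)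
    · exact M.eq_of_mem_right h h'
    · exact hdisj m m' w h hl h' hl'
    · exact (hdisj m' m w h' hl' h hl).symm
    · exact L.eq_of_mem_right h h'
  · intro m w h
    rcases M.dominated h with ⟨w1, hw1, l1⟩ | ⟨m1, hm1, l1⟩
    · rcases L.dominated h with ⟨w2, hw2, l2⟩ | ⟨m2, hm2, l2⟩
      · obtain ⟨w', hw', he⟩ := hcov m w1 w2 hw1 hw2
        exact Or.inl ⟨w', hw', he.trans_le (max_le l1 l2)⟩
      · obtain ⟨m1, hm1⟩ := covered_right L M hm2
        obtain ⟨m', hm', -, hle⟩ := hdom m1 m2 w hm1 hm2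
        exact Or.inr ⟨m', hm', hle.trans l2⟩
    · obtain ⟨m2, hm2⟩ := covered_right M L hm1
      obtain ⟨m', hm', hle, -⟩ := hdom m1 m2 w hm1 hm2
      exact Or.inr ⟨m', hm', hle.trans l1⟩
  · intro m
    by_cases hm : ∃ w, (m, w) ∈ M.edges
    · obtain ⟨w1, hw1⟩ := hm
      obtain ⟨w2, hw2⟩ := covered_left M L hw1
      obtain ⟨w', hw', he⟩ := hcov m w1 w2 hw1 hw2
      rw [M.pos_eq hw1, L.pos_eq hw2, ← he]
      exact pos_eq _ hw'
    · push Not at hm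
      rw [M.pos_of_forall_notMem hm, L.pos_of_forall_notMem fun w hw =>
        (covered_left L M hw).elim hm, max_self]
      refine pos_of_forall_notMem _ fun w hw => ?_
      rcases hw with hw | hw
      · exact hm w hw.1
      · exact (covered_left L M hw.1).elim hm

/-- Every vertex of `I` can be given the better of its edges in two stable matchings. -/
theorem exists_inf (M L : G.StableMatching) :
    ∃ N : G.StableMatching, ∀ m, N.pos m = min (M.pos m) (L.pos m) := by
  have worse : ∀ (M L : G.StableMatching) m m' w, (m, w) ∈ M.edges → (m', w) ∈ L.edges →
      G.rankJ w m' ≤ G.rankJ w m → ∀ w', (m, w') ∈ L.edges → G.rankI m w ≤ G.rankI m w' := by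
    intro M L m m' w h h' hle w' hw'
    rcases hle.eq_or_lt with he | hlt
    · obtain rfl := rankJ_inj (L.mem_E h') (M.mem_E h) he
      rw [L.eq_of_mem_left hw' h']
    · exact (rankI_lt_of_rankJ_gt M L h h' hlt hw').le
  let N : Set (I × J) := {e | (e ∈ M.edges ∧ ∀ w', (e.1, w') ∈ L.edges →
    G.rankI e.1 e.2 ≤ G.rankI e.1 w') ∨ (e ∈ L.edges ∧ ∀ w', (e.1, w') ∈ M.edges →
    G.rankI e.1 e.2 ≤ G.rankI e.1 w')}
  have hdisj : ∀ m m' w, (m, w) ∈ M.edges → (∀ w', (m, w') ∈ L.edges →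
      G.rankI m w ≤ G.rankI m w') → (m', w) ∈ L.edges → (∀ w', (m', w') ∈ M.edges →
      G.rankI m' w ≤ G.rankI m' w') → m = m' := by
    intro m m' w h1 h2 h3 h4
    by_contra hne
    obtain ⟨w1, hw1⟩ := covered_left M L h1
    obtain ⟨w2, hw2⟩ := covered_left L M h3
    rcases lt_trichotomy (G.rankJ w m) (G.rankJ w m') with hl | he | hl
    · exact (h2 w1 hw1).not_gt (rankI_lt_of_rankJ_lt M L h1 h3 hl hw1)
    · exact hne (rankJ_inj (M.mem_E h1) (L.mem_E h3) he)
    · exact (h4 w2 hw2).not_gt (rankI_lt_of_rankJ_lt L M h3 h1 hl hw2)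
  have hNE : N ⊆ G.E := fun e he => he.elim (fun h => M.mem_E h.1) fun h => L.mem_E h.1
  have hcov : ∀ m w1 w2, (m, w1) ∈ M.edges → (m, w2) ∈ L.edges →
      ∃ w', (m, w') ∈ N ∧ G.rankI m w' = min (G.rankI m w1) (G.rankI m w2) := by
    intro m w1 w2 h1 h2
    rcases le_total (G.rankI m w1) (G.rankI m w2) with hle | hle
    · exact ⟨w1, Or.inl ⟨h1, fun w' hw' => by rwa [L.eq_of_mem_left hw' h2]⟩,
        (min_eq_left hle).symm⟩
    · exact ⟨w2, Or.inr ⟨h2, fun w' hw' => by rwa [M.eq_of_mem_left hw' h1]⟩,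
        (min_eq_right hle).symm⟩
  refine ⟨ofDominated N hNE ?_ ?_ ?_, ?_⟩
  · rintro m w w' (⟨h, hl⟩ | ⟨h, hl⟩) (⟨h', hl'⟩ | ⟨h', hl'⟩)
    · exact M.eq_of_mem_left h h'
    · exact rankI_inj (M.mem_E h) (L.mem_E h') ((hl w' h').antisymm (hl' w h))
    · exact rankI_inj (L.mem_E h) (M.mem_E h') ((hl w' h').antisymm (hl' w h))
    · exact L.eq_of_mem_left h h'
  · rintro m m' w (⟨h, hl⟩ | ⟨h, hl⟩) (⟨h', hl'⟩ | ⟨h', hl'⟩)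
    · exact M.eq_of_mem_right h h'
    · exact hdisj m m' w h hl h' hl'
    · exact (hdisj m' m w h' hl' h hl).symm
    · exact L.eq_of_mem_right h h'
  · intro m w h
    rcases M.dominated h with ⟨w1, hw1, l1⟩ | ⟨m1, hm1, l1⟩
    · obtain ⟨w2, hw2⟩ := covered_left M L hw1
      obtain ⟨w', hw', he⟩ := hcov m w1 w2 hw1 hw2
      exact Or.inl ⟨w', hw', he.trans_le ((min_le_left _ _).trans l1)⟩
    · rcases L.dominated h with ⟨w2, hw2, l2⟩ | ⟨m2, hm2, l2⟩
      · obtain ⟨w1, hw1⟩ := covered_left L M hw2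
        obtain ⟨w', hw', he⟩ := hcov m w1 w2 hw1 hw2
        exact Or.inl ⟨w', hw', he.trans_le ((min_le_right _ _).trans l2)⟩
      -- Here both matchings dominate the edge at `w`, so the worse of the two edges of `w`, which
      -- belongs to `N`, dominates it as well.
      · right
        rcases le_total (G.rankJ w m1) (G.rankJ w m2) with hle | hle
        · exact ⟨m2, Or.inr ⟨hm2, worse L M m2 m1 w hm2 hm1 hle⟩, l2⟩
        · exact ⟨m1, Or.inl ⟨hm1, worse M L m1 m2 w hm1 hm2 hle⟩, l1⟩
  · intro m
    by_cases hm : ∃ w, (m, w) ∈ M.edges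
    · obtain ⟨w1, hw1⟩ := hm
      obtain ⟨w2, hw2⟩ := covered_left M L hw1
      obtain ⟨w', hw', he⟩ := hcov m w1 w2 hw1 hw2
      rw [M.pos_eq hw1, L.pos_eq hw2, ← he]
      exact pos_eq _ hw'
    · push Not at hm
      rw [M.pos_of_forall_notMem hm, Nat.zero_min]
      refine pos_of_forall_notMem _ fun w hw => ?_
      rcases hw with hw | hw
      · exact hm w hw.1
      · exact (covered_left L M hw.1).elim hm

/-- The lattice of stable matchings. -/
noncomputable abbrev lattice (G : PrefGraph I J) : Lattice G.StableMatching where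
  le := Prec
  le_refl M := (prec_iff M M).2 fun _ => le_rfl
  le_trans M L N h h' := (prec_iff M N).2 fun m =>
    ((prec_iff M L).1 h m).trans ((prec_iff L N).1 h' m)
  le_antisymm M L h h' := pos_injective <| funext fun m =>
    ((prec_iff M L).1 h m).antisymm ((prec_iff L M).1 h' m)
  sup M L := (exists_sup M L).choose
  inf M L := (exists_inf M L).choose
  le_sup_left M L := (prec_iff _ _).2 fun m => by
    rw [(exists_sup M L).choose_spec]; exact le_max_left _ _
  le_sup_right M L := (prec_iff _ _).2 fun m => by
    rw [(exists_sup M L).choose_spec]; exact le_max_right _ _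
  sup_le M L N h h' := (prec_iff _ _).2 fun m => by
    rw [(exists_sup M L).choose_spec]
    exact max_le ((prec_iff _ _).1 h m) ((prec_iff _ _).1 h' m)
  inf_le_left M L := (prec_iff _ _).2 fun m => by
    rw [(exists_inf M L).choose_spec]; exact min_le_left _ _
  inf_le_right M L := (prec_iff _ _).2 fun m => by
    rw [(exists_inf M L).choose_spec]; exact min_le_right _ _
  le_inf M L N h h' := (prec_iff _ _).2 fun m => by
    rw [(exists_inf L N).choose_spec]
    exact le_min ((prec_iff _ _).1 h m) ((prec_iff _ _).1 h' m)

/-- A matching with the fewest matchings below it cannot change when it is met with any `L`. -/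
theorem exists_isMmin : ∃ M : G.StableMatching, M.IsMmin := by
  let _ := lattice G
  obtain ⟨M0⟩ := nonempty (G := G)
  obtain ⟨M, -, hM⟩ := Set.exists_min_image (Set.univ : Set G.StableMatching)
    (fun M => {L : G.StableMatching | L ≤ M}.ncard) (Set.toFinite _) ⟨M0, trivial⟩
  have h : ∀ L, M.Prec L := fun L => by
    have h1 : M ⊓ L ≤ M := inf_le_left
    have h2 := Set.eq_of_subset_of_ncard_le
      (show {N | N ≤ M ⊓ L} ⊆ {N | N ≤ M} from fun N hN => hN.trans h1)
      (hM _ trivial) (Set.toFinite _)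
    have h3 : M ≤ M ⊓ L := h2.symm.subset (le_refl M)
    exact h3.trans inf_le_right
  exact ⟨M, fun L => ⟨h L, betterJ_of_prec (h L)⟩⟩

theorem exists_isMmax : ∃ M : G.StableMatching, M.IsMmax := by
  let _ := lattice G
  obtain ⟨M0⟩ := nonempty (G := G)
  obtain ⟨M, -, hM⟩ := Set.exists_min_image (Set.univ : Set G.StableMatching)
    (fun M => {L : G.StableMatching | M ≤ L}.ncard) (Set.toFinite _) ⟨M0, trivial⟩
  have h : ∀ L : G.StableMatching, L.Prec M := fun L => by
    have h1 : M ≤ M ⊔ L := le_sup_left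
    have h2 := Set.eq_of_subset_of_ncard_le
      (show {N | M ⊔ L ≤ N} ⊆ {N | M ≤ N} from fun N hN => h1.trans hN)
      (hM _ trivial) (Set.toFinite _)
    have h3 : M ⊔ L ≤ M := h2.symm.subset (le_refl M)
    exact le_sup_right.trans h3
  exact ⟨M, fun L => ⟨betterJ_of_prec (h L), h L⟩⟩

end StableMatching

end PrefGraph

/-! ### Active edges and the structure of rotations. -/

namespace PrefGraph

variable {I J : Type*} {G : PrefGraph I J}

namespace StableMatching

theorem Active.notMem {M : G.StableMatching} {m : I} {w : J} (h : M.Active m w) :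
    (m, w) ∉ M.edges :=
  h.1.2.1

theorem Active.eq [Finite J] {M : G.StableMatching} {m : I} {w w' : J} (h : M.Active m w)
    (h' : M.Active m w') : w = w' := by
  rcases h.2 w' h'.1 with h1 | h1
  · exact h1
  rcases h'.2 w h.1 with h2 | h2
  · exact h2.symm
  · rw [ltI_iff h.1.1 h'.1.1] at h1
    rw [ltI_iff h'.1.1 h.1.1] at h2
    exact absurd h1 h2.asymm

theorem Active.rankI_le [Finite J] {M : G.StableMatching} {m : I} {w w' : J} (h : M.Active m w)
    (h' : M.Admissible m w') : G.rankI m w ≤ G.rankI m w' := by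
  rcases h.2 w' h' with rfl | h1
  · exact le_rfl
  · exact ((ltI_iff h.1.1 h'.1).1 h1).le

theorem Active.pos_lt [Finite J] {M : G.StableMatching} {m : I} {w : J} (h : M.Active m w) :
    M.pos m < G.rankI m w := by
  obtain ⟨w', hw', hlt⟩ := h.1.2.2.1
  rw [M.pos_eq hw']
  exact (ltI_iff (M.mem_E hw') h.1.1).1 hlt

theorem Admissible.exists_active [Finite J] {M : G.StableMatching} {m : I} {w : J}
    (h : M.Admissible m w) : ∃ w', M.Active m w' := by
  obtain ⟨w', hw', hmin⟩ := Set.exists_min_image {w | M.Admissible m w} (G.rankI m)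
    (Set.toFinite _) ⟨w, h⟩
  refine ⟨w', hw', fun w'' hw'' => ?_⟩
  rcases (hmin w'' hw'').eq_or_lt with he | hlt
  · exact Or.inl (rankI_inj hw'.1 hw''.1 he)
  · exact Or.inr ((ltI_iff hw'.1 hw''.1).2 hlt)

variable [Finite I] [Finite J]

/-- Since `N` is better for J, `u` accepts its new edge over its edge in `M`. This is what forbids a
worse stable matching to stop short of the active edge. -/
theorem Prec.admissible {M N : G.StableMatching} (h : M.Prec N) {m : I} {u : J}
    (hu : (m, u) ∈ N.edges) (hlt : M.pos m < N.pos m) : M.Admissible m u := by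
  have hn : (m, u) ∉ M.edges := fun hM => by
    rw [M.pos_eq hM, N.pos_eq hu] at hlt
    exact hlt.false
  refine ⟨N.mem_E hu, hn, ?_, fun m' hm' => ?_⟩
  · obtain ⟨w, hw⟩ := covered_left N M hu
    rw [M.pos_eq hw, N.pos_eq hu] at hlt
    exact ⟨w, hw, (ltI_iff (M.mem_E hw) (N.mem_E hu)).2 hlt⟩
  · rcases betterJ_of_prec h u m m' hu hm' with rfl | hl
    · exact absurd hm' hn
    · exact hl

omit [Finite I] [Finite J] in
theorem exists_mem_of_pos_lt {M N : G.StableMatching} {m : I} (hlt : M.pos m < N.pos m) :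
    ∃ u, (m, u) ∈ N.edges := by
  by_contra! hc
  rw [N.pos_of_forall_notMem hc] at hlt
  exact absurd hlt (Nat.not_lt_zero _)

theorem Prec.rankI_le_pos {M N : G.StableMatching} (h : M.Prec N) {m : I} {w : J}
    (hw : M.Active m w) (hlt : M.pos m < N.pos m) : G.rankI m w ≤ N.pos m := by
  obtain ⟨u, hu⟩ := exists_mem_of_pos_lt hlt
  rw [N.pos_eq hu]
  exact hw.rankI_le (h.admissible hu hlt)

/-- If `N` is worse than `M` at `m`, then also at the vertex matched by `M` with the end of the
active edge of `m`. -/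
theorem Prec.exists_next {M N : G.StableMatching} (h : M.Prec N) {m : I} {w : J}
    (hw : M.Active m w) (hlt : M.pos m < N.pos m) :
    ∃ m', (m', w) ∈ M.edges ∧ M.pos m' < N.pos m' := by
  obtain ⟨u, hu⟩ := exists_mem_of_pos_lt hlt
  -- At `m`, `N` lies at or beyond the active edge `mw`; so `N` contains `mw` or dominates it at
  -- `w`. Therefore `w` cannot keep in `N` its partner from `M`, which it likes less than `m`.
  obtain ⟨m1, hm1, hle⟩ : ∃ m1, (m1, w) ∈ N.edges ∧ G.rankJ w m1 ≤ G.rankJ w m := by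
    by_cases hwu : (m, w) ∈ N.edges
    · exact ⟨m, hwu, le_rfl⟩
    rcases N.dominated hw.1.1 with ⟨w', hw', hl⟩ | h1
    · have h2 := h.rankI_le_pos hw hlt
      rw [N.pos_eq hw'] at h2
      obtain rfl := rankI_inj (N.mem_E hw') hw.1.1 (hl.antisymm h2)
      exact absurd hw' hwu
    · exact h1
  obtain ⟨m', hm'⟩ := covered_right N M hm1
  refine ⟨m', hm', lt_of_le_of_ne ((prec_iff M N).1 h m') fun he => ?_⟩
  obtain ⟨w', hw'⟩ := covered_left M N hm'
  obtain rfl := eq_of_pos_eq M N hm' hw' he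
  obtain rfl := N.eq_of_mem_right hm1 hw'
  exact hle.not_gt ((ltJ_iff hw.1.1 (M.mem_E hm')).1 (hw.1.2.2.2 _ hm'))

omit [Finite I] [Finite J] in
theorem activeGraph_adj {M : G.StableMatching} {x y : I ⊕ J} (h : M.activeGraph.Adj x y) :
    ∃ m w, ((m, w) ∈ M.edges ∨ M.Active m w) ∧
      (x = Sum.inl m ∧ y = Sum.inr w ∨ x = Sum.inr w ∧ y = Sum.inl m) := by
  rw [activeGraph, SimpleGraph.fromEdgeSet_adj] at h
  obtain ⟨⟨m, w, h1, h2⟩, -⟩ := h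
  exact ⟨m, w, h1, by simpa using h2⟩

/-- The structure of a rotation: it consists of the edges of `M` and the active edges at a set `S`
of vertices; these form a single cycle alternating between the two kinds of edges. -/
theorem IsRotation.exists_support {M : G.StableMatching} {C : Set (I × J)} (hC : M.IsRotation C) :
    ∃ S : Set I, S.Nonempty ∧ (∀ m w, (m, w) ∈ C ↔ m ∈ S ∧ ((m, w) ∈ M.edges ∨ M.Active m w)) ∧
      (∀ m ∈ S, ∃ w w', (m, w) ∈ M.edges ∧ M.Active m w' ∧ ∃ m' ∈ S, (m', w') ∈ M.edges) ∧
      (∀ m ∈ S, ∀ m' ∈ S, ∀ w, M.Active m w → M.Active m' w → m = m') ∧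
      ∀ T ⊆ S, T.Nonempty → (∀ m ∈ T, ∀ m' ∈ S, ∀ w, M.Active m w → (m', w) ∈ M.edges → m' ∈ T) →
        T = S := by
  obtain ⟨v, p, hp, rfl⟩ := hC
  set H := p.toSubgraph with hH
  have hmem : ∀ m w, (m, w) ∈ {e : I × J | s(Sum.inl e.1, Sum.inr e.2) ∈ p.edges} ↔
      H.Adj (Sum.inl m) (Sum.inr w) := by
    intro m w
    rw [← SimpleGraph.Subgraph.mem_edgeSet, hH, SimpleGraph.Walk.mem_edges_toSubgraph]
    rfl
  have hadj : ∀ m w, H.Adj (Sum.inl m) (Sum.inr w) → (m, w) ∈ M.edges ∨ M.Active m w := by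
    intro m w h
    obtain ⟨m', w', h1, h2⟩ := activeGraph_adj h.adj_sub
    simp only [Sum.inl.injEq, Sum.inr.injEq, reduceCtorEq, and_self, or_false] at h2
    obtain ⟨rfl, rfl⟩ := h2
    exact h1
  have htwo : ∀ x ∈ p.support, ∃ y z, y ≠ z ∧ H.Adj x y ∧ H.Adj x z := by
    intro x hx
    obtain ⟨y, z, hyz, he⟩ := Set.ncard_eq_two.1 (hp.ncard_neighborSet_toSubgraph_eq_two hx)
    have h1 : y ∈ H.neighborSet x := he ▸ Set.mem_insert _ _
    have h2 : z ∈ H.neighborSet x := he ▸ Set.mem_insert_of_mem _ rfl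
    exact ⟨y, z, hyz, h1, h2⟩
  have hsupp : ∀ {x y}, H.Adj x y → x ∈ p.support := fun h =>
    p.mem_verts_toSubgraph.1 (H.edge_vert h)
  let S : Set I := {m | Sum.inl m ∈ p.support}
  let T : Set J := {w | Sum.inr w ∈ p.support}
  have hST : ∀ m ∈ S, ∃ w w', (m, w) ∈ M.edges ∧ M.Active m w' ∧
      H.Adj (Sum.inl m) (Sum.inr w) ∧ H.Adj (Sum.inl m) (Sum.inr w') := by
    intro m hm
    obtain ⟨y, z, hyz, hy, hz⟩ := htwo _ hm
    obtain ⟨m1, w1, -, h1⟩ := activeGraph_adj hy.adj_sub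
    obtain ⟨m2, w2, -, h2⟩ := activeGraph_adj hz.adj_sub
    simp only [Sum.inl.injEq, reduceCtorEq, false_and, or_false] at h1 h2
    obtain ⟨rfl, rfl⟩ := h1
    obtain ⟨rfl, rfl⟩ := h2
    have hne : w1 ≠ w2 := fun h => hyz (by rw [h])
    rcases hadj _ _ hy with h1 | h1 <;> rcases hadj _ _ hz with h2 | h2
    · exact absurd (M.eq_of_mem_left h1 h2) hne
    · exact ⟨w1, w2, h1, h2, hy, hz⟩
    · exact ⟨w2, w1, h2, h1, hz, hy⟩
    · exact absurd (h1.eq h2) hne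
  have hTS : ∀ w ∈ T, ∃ m ∈ S, M.Active m w := by
    intro w hw
    obtain ⟨y, z, hyz, hy, hz⟩ := htwo _ hw
    obtain ⟨m1, w1, -, h1⟩ := activeGraph_adj hy.adj_sub
    obtain ⟨m2, w2, -, h2⟩ := activeGraph_adj hz.adj_sub
    simp only [Sum.inr.injEq, reduceCtorEq, false_and, false_or] at h1 h2
    obtain ⟨rfl, rfl⟩ := h1
    obtain ⟨rfl, rfl⟩ := h2
    have hne : m1 ≠ m2 := fun h => hyz (by rw [h])
    rcases hadj _ _ hy.symm with h1 | h1
    · rcases hadj _ _ hz.symm with h2 | h2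
      · exact absurd (M.eq_of_mem_right h1 h2) hne
      · exact ⟨m2, hsupp hz.symm, h2⟩
    · exact ⟨m1, hsupp hy.symm, h1⟩
  -- A vertex of the cycle in I has one edge of each kind; one in J might still have two active
  -- edges. Counting excludes this: `a` and `b` are injections between `S` and `T` in opposite
  -- directions, hence bijections.
  have ha : ∀ m : S, ∃ w : T, (m.1, w.1) ∈ M.edges := fun m =>
    let ⟨w, _, h, _, h', _⟩ := hST m.1 m.2
    ⟨⟨w, hsupp h'.symm⟩, h⟩
  have hb : ∀ w : T, ∃ m : S, M.Active m.1 w.1 := fun w =>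
    let ⟨m, hm, h⟩ := hTS w.1 w.2
    ⟨⟨m, hm⟩, h⟩
  choose a ha using ha
  choose b hb using hb
  have hai : Function.Injective a := fun x y hxy =>
    Subtype.ext (M.eq_of_mem_right (ha x) (hxy ▸ ha y))
  have hbi : Function.Injective b := fun x y hxy =>
    Subtype.ext ((hb x).eq (hxy ▸ hb y))
  have has : Function.Surjective a :=
    (Finite.surjective_of_injective (hai.comp hbi)).of_comp
  have hbs : Function.Surjective b :=
    (Finite.surjective_of_injective (hbi.comp hai)).of_comp
  have hinj : ∀ m ∈ S, ∀ m' ∈ S, ∀ w, M.Active m w → M.Active m' w → m = m' := by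
    intro m hm m' hm' w h h'
    obtain ⟨x, hx⟩ := hbs ⟨m, hm⟩
    obtain ⟨y, hy⟩ := hbs ⟨m', hm'⟩
    have h1 := hb x
    have h2 := hb y
    rw [hx] at h1
    rw [hy] at h2
    have hxy : x = y := Subtype.ext ((h1.eq h).trans (h'.eq h2))
    exact congrArg Subtype.val (hx.symm.trans ((congrArg b hxy).trans hy))
  have hnext : ∀ m ∈ S, ∀ w, M.Active m w → ∃ m' ∈ S, (m', w) ∈ M.edges := by
    intro m hm w hw
    obtain ⟨_, w', -, h2, -, h4⟩ := hST m hm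
    obtain rfl := hw.eq h2
    obtain ⟨m', hm'⟩ := has ⟨w, hsupp h4.symm⟩
    have := ha m'
    rw [hm'] at this
    exact ⟨m', m'.2, this⟩
  refine ⟨S, ?_, fun m w => (hmem m w).trans ⟨fun h => ⟨hsupp h, hadj _ _ h⟩, ?_⟩, ?_, hinj, ?_⟩
  · have hv : v ∈ p.support := p.start_mem_support
    rcases v with m | w
    · exact ⟨m, hv⟩
    · obtain ⟨m, hm, -⟩ := hTS w hv
      exact ⟨m, hm⟩
  · rintro ⟨hm, h⟩
    obtain ⟨w1, w2, h1, h2, h3, h4⟩ := hST m hm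
    rcases h with h | h
    · rwa [M.eq_of_mem_left h h1]
    · rwa [h.eq h2]
  · intro m hm
    obtain ⟨w1, w2, h1, h2, -⟩ := hST m hm
    exact ⟨w1, w2, h1, h2, hnext m hm w2 h2⟩
  · intro U hUS ⟨m0, hm0⟩ hU
    have hc : ∀ m : U, ∃ m' : U, ∃ w, M.Active m.1 w ∧ (m'.1, w) ∈ M.edges := by
      rintro ⟨m, hm⟩
      obtain ⟨_, w, -, hw, -⟩ := hST m (hUS hm)
      obtain ⟨m', hm', h'⟩ := hnext m (hUS hm) w hw
      exact ⟨⟨m', hU m hm m' hm' w hw h'⟩, w, hw, h'⟩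
    choose c hc using hc
    have hci : Function.Injective c := by
      intro x y hxy
      obtain ⟨w, h1, h2⟩ := hc x
      obtain ⟨w', h3, h4⟩ := hc y
      rw [hxy] at h2
      obtain rfl := M.eq_of_mem_left h2 h4
      exact Subtype.ext (hinj _ (hUS x.2) _ (hUS y.2) w h1 h3)
    have hcs := Finite.surjective_of_injective hci
    -- `Q` extends `U` to J along `M`. As the successor map `c` permutes `U`, membership is
    -- invariant along every edge of the cycle, so it is constant on the cycle.
    let Q : I ⊕ J → Prop := Sum.elim (· ∈ U) (fun w => ∃ m ∈ U, (m, w) ∈ M.edges)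
    have hQ1 : ∀ m w, H.Adj (Sum.inl m) (Sum.inr w) → (m ∈ U ↔ ∃ m ∈ U, (m, w) ∈ M.edges) := by
      intro m w h
      rcases hadj m w h with h1 | h1
      · refine ⟨fun hm => ⟨m, hm, h1⟩, ?_⟩
        rintro ⟨m', hm', h2⟩
        rwa [M.eq_of_mem_right h1 h2]
      · constructor
        · intro hm
          obtain ⟨m', hm', h'⟩ := hnext m (hUS hm) w h1
          exact ⟨m', hU m hm m' hm' w h1 h', h'⟩
        · rintro ⟨m', hm', h2⟩
          obtain ⟨x, hx⟩ := hcs ⟨m', hm'⟩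
          obtain ⟨w', h3, h4⟩ := hc x
          rw [hx] at h4
          obtain rfl := M.eq_of_mem_left h2 h4
          rw [hinj m (hsupp h) x (hUS x.2) w h1 h3]
          exact x.2
    have hQ : ∀ x y, H.Adj x y → (Q x ↔ Q y) := by
      intro x y h
      obtain ⟨m, w, -, ⟨rfl, rfl⟩ | ⟨rfl, rfl⟩⟩ := activeGraph_adj h.adj_sub
      · exact hQ1 m w h
      · exact (hQ1 m w h.symm).symm
    have hQv : ∀ i ≤ p.length, (Q (p.getVert i) ↔ Q v) := by
      intro i
      induction i with
      | zero => intro _; rw [p.getVert_zero]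
      | succ i ih =>
        intro hi
        exact (hQ _ _ (p.toSubgraph_adj_getVert hi)).symm.trans (ih (by omega))
    have hQs : ∀ x ∈ p.support, (Q x ↔ Q v) := by
      intro x hx
      obtain ⟨i, rfl, hi⟩ := SimpleGraph.Walk.mem_support_iff_exists_getVert.1 hx
      exact hQv i hi
    refine hUS.antisymm fun m hm => ?_
    have h1 : Q (Sum.inl m0) := hm0
    exact (hQs _ hm).2 ((hQs _ (hUS hm0)).1 h1)

/-- If `L` is worse than `M`, there is a rotation for `M` all of whose vertices in `I` are worse off
in `L` than in `M`. -/
theorem Prec.exists_isRotation {M L : G.StableMatching} (h : M.Prec L) (hne : M ≠ L) :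
    ∃ C, M.IsRotation C ∧ ∀ e ∈ C, M.pos e.1 < L.pos e.1 := by
  let S : Set I := {m | M.pos m < L.pos m}
  obtain ⟨m0, hm0⟩ : ∃ m, m ∈ S := by
    by_contra! hc
    exact hne (pos_injective (funext fun m => ((prec_iff M L).1 h m).antisymm (not_lt.1 (hc m))))
  have hf : ∀ m : S, ∃ m' : S, ∃ w, M.Active m.1 w ∧ (m'.1, w) ∈ M.edges := by
    rintro ⟨m, hm⟩
    obtain ⟨u, hu⟩ := exists_mem_of_pos_lt hm
    obtain ⟨w, hw⟩ := (h.admissible hu hm).exists_active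
    obtain ⟨m', h1, h2⟩ := h.exists_next hw hm
    exact ⟨⟨m', h2⟩, w, hw, h1⟩
  choose f hf using hf
  obtain ⟨x, hx⟩ : ∃ x, x ∈ Function.periodicPts f := by
    obtain ⟨a, b, hab, he⟩ := Finite.exists_ne_map_eq_of_infinite fun n => f^[n] ⟨m0, hm0⟩
    wlog hlt : a < b generalizing a b
    · exact this b a hab.symm he.symm (lt_of_le_of_ne (not_lt.1 hlt) hab.symm)
    refine ⟨f^[a] ⟨m0, hm0⟩, b - a, Nat.sub_pos_of_lt hlt, ?_⟩
    rw [Function.IsPeriodicPt, Function.IsFixedPt, ← Function.iterate_add_apply,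
      Nat.sub_add_cancel hlt.le]
    exact he.symm
  -- In the part of the active graph incident with `S`, the orbit of the periodic point `x` leads
  -- back to its partner `w0` without using the edge `x w0`. Hence this edge lies on a cycle; which
  -- cycle does not matter, as its vertices in I all belong to `S`.
  let H : SimpleGraph (I ⊕ J) := SimpleGraph.fromEdgeSet
    {e | ∃ m w, m ∈ S ∧ ((m, w) ∈ M.edges ∨ M.Active m w) ∧ e = s(Sum.inl m, Sum.inr w)}
  have hHadj : ∀ m w, m ∈ S → ((m, w) ∈ M.edges ∨ M.Active m w) →
      H.Adj (Sum.inl m) (Sum.inr w) := fun m w hm h =>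
    (SimpleGraph.fromEdgeSet_adj _).2 ⟨⟨m, w, hm, h, rfl⟩, Sum.inl_ne_inr⟩
  have hle : H ≤ M.activeGraph := SimpleGraph.fromEdgeSet_mono (by
    rintro e ⟨m, w, -, h, he⟩
    exact ⟨m, w, h, he⟩)
  obtain ⟨w0, hw0⟩ : ∃ w, (x.1, w) ∈ M.edges := by
    obtain ⟨u, hu⟩ := exists_mem_of_pos_lt x.2
    exact covered_left L M hu
  set n := Function.minimalPeriod f x with hn
  have hnpos : 0 < n := Function.minimalPeriod_pos_of_mem_periodicPts hx
  have hdel : ∀ m w, m ∈ S → ((m, w) ∈ M.edges ∨ M.Active m w) → ¬ (m = x.1 ∧ w = w0) →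
      (H.deleteEdges {s(Sum.inl x.1, Sum.inr w0)}).Adj (Sum.inl m) (Sum.inr w) := by
    intro m w hm h hne
    rw [SimpleGraph.deleteEdges_adj]
    exact ⟨hHadj m w hm h, by simpa using hne⟩
  have hreach : ∀ i < n, (H.deleteEdges {s(Sum.inl x.1, Sum.inr w0)}).Reachable
      (Sum.inl x.1) (Sum.inl (f^[i] x).1) := by
    intro i
    induction i with
    | zero => intro _; exact SimpleGraph.Reachable.refl _
    | succ i ih =>
      intro hi
      obtain ⟨w, h1, h2⟩ := hf (f^[i] x)
      rw [← Function.iterate_succ_apply' f] at h2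
      refine (ih (by omega)).trans ((hdel _ w (f^[i] x).2 (Or.inr h1) ?_).reachable.trans
        (hdel _ w (f^[i + 1] x).2 (Or.inl h2) ?_).reachable.symm)
      · rintro ⟨h3, rfl⟩
        exact h1.notMem (h3 ▸ hw0)
      · rintro ⟨h3, -⟩
        exact Function.not_isPeriodicPt_of_pos_of_lt_minimalPeriod (Nat.succ_ne_zero i) hi
          (Subtype.ext h3)
  have hlast : (H.deleteEdges {s(Sum.inl x.1, Sum.inr w0)}).Reachable
      (Sum.inl x.1) (Sum.inr w0) := by
    obtain ⟨w, h1, h2⟩ := hf (f^[n - 1] x)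
    rw [← Function.iterate_succ_apply' f, Nat.succ_eq_add_one, Nat.sub_add_cancel hnpos,
      hn, Function.iterate_minimalPeriod] at h2
    obtain rfl := M.eq_of_mem_left h2 hw0
    refine (hreach (n - 1) (by omega)).trans (hdel _ w (f^[n - 1] x).2 (Or.inr h1) ?_).reachable
    rintro ⟨h3, -⟩
    exact h1.notMem (h3 ▸ hw0)
  obtain ⟨v, c, hc, -⟩ := SimpleGraph.adj_and_reachable_delete_edges_iff_exists_cycle.1
    ⟨hHadj _ _ x.2 (Or.inl hw0), hlast⟩
  refine ⟨_, ⟨v, c.mapLe hle, hc.mapLe hle, rfl⟩, ?_⟩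
  rintro ⟨m, w⟩ he
  rw [Set.mem_ofPred_eq, SimpleGraph.Walk.edges_mapLe_eq_edges] at he
  have h1 := (SimpleGraph.fromEdgeSet_adj _).1 (c.adj_of_mem_edges he)
  obtain ⟨⟨m', w', hm', -, he'⟩, -⟩ := h1
  simp only [Sym2.eq, Sym2.rel_iff', Prod.mk.injEq, Sum.inl.injEq, Sum.inr.injEq, Prod.swap_prod_mk,
    reduceCtorEq, and_self, or_false] at he'
  rw [he'.1]
  exact hm'

end StableMatching

end PrefGraph

/-! ### Elimination of a rotation. -/

namespace PrefGraph

variable {I J : Type*} {G : PrefGraph I J}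

namespace StableMatching

/-- `M'` arises from `M` by eliminating the rotation `C`. -/
def Step (M : G.StableMatching) (C : Set (I × J)) (M' : G.StableMatching) : Prop :=
  M.IsRotation C ∧ M'.edges = symmDiff M.edges C

variable [Finite I] [Finite J]

omit [Finite I] [Finite J] in
/-- The edges after the elimination of a rotation. -/
theorem mem_symmDiff_iff {M : G.StableMatching} {C : Set (I × J)} {S : Set I}
    (hC : ∀ m w, (m, w) ∈ C ↔ m ∈ S ∧ ((m, w) ∈ M.edges ∨ M.Active m w)) (m : I) (w : J) :
    (m, w) ∈ symmDiff M.edges C ↔ m ∉ S ∧ (m, w) ∈ M.edges ∨ m ∈ S ∧ M.Active m w := by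
  rw [Set.mem_symmDiff, hC]
  constructor
  · rintro (⟨h1, h2⟩ | ⟨⟨h1, h2⟩, h3⟩)
    · exact Or.inl ⟨fun hm => h2 ⟨hm, Or.inl h1⟩, h1⟩
    · exact Or.inr ⟨h1, h2.resolve_left h3⟩
  · rintro (⟨h1, h2⟩ | ⟨h1, h2⟩)
    · exact Or.inl ⟨h2, fun h => h1 h.1⟩
    · exact Or.inr ⟨⟨h1, Or.inr h2⟩, h2.notMem⟩

/-- Eliminating a rotation yields a stable matching. -/
theorem IsRotation.exists_step {M : G.StableMatching} {C : Set (I × J)} (hC : M.IsRotation C) :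
    ∃ M', M.Step C M' := by
  obtain ⟨S, -, hCS, hS, hinj, -⟩ := hC.exists_support
  have hmem := mem_symmDiff_iff hCS
  -- No covered vertex of J loses: the successor map permutes `S`, so a `w` abandoned by `m` is the
  -- end of the active edge of the predecessor of `m`, which `w` prefers.
  have hcov : ∀ m w, (m, w) ∈ M.edges →
      ∃ m', (m', w) ∈ symmDiff M.edges C ∧ G.rankJ w m' ≤ G.rankJ w m := by
    intro m w h
    by_cases hm : m ∈ S
    · have hnext : ∀ m : S, ∃ m' : S, ∃ w, M.Active m.1 w ∧ (m'.1, w) ∈ M.edges := fun m =>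
        let ⟨_, w', _, h2, m', hm', h3⟩ := hS m.1 m.2
        ⟨⟨m', hm'⟩, w', h2, h3⟩
      choose f hf using hnext
      have hfi : Function.Injective f := by
        intro x y hxy
        obtain ⟨w, h1, h2⟩ := hf x
        obtain ⟨w', h3, h4⟩ := hf y
        rw [hxy] at h2
        obtain rfl := M.eq_of_mem_left h2 h4
        exact Subtype.ext (hinj _ x.2 _ y.2 w h1 h3)
      obtain ⟨x, hx⟩ := Finite.surjective_of_injective hfi ⟨m, hm⟩
      obtain ⟨w', h1, h2⟩ := hf x
      rw [hx] at h2
      obtain rfl := M.eq_of_mem_left h h2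
      exact ⟨x, (hmem _ _).2 (Or.inr ⟨x.2, h1⟩),
        ((ltJ_iff h1.1.1 (M.mem_E h)).1 (h1.1.2.2.2 m h)).le⟩
    · exact ⟨m, (hmem _ _).2 (Or.inl ⟨hm, h⟩), le_rfl⟩
  have hE : symmDiff M.edges C ⊆ G.E := by
    rintro ⟨m, w⟩ h
    rcases (hmem m w).1 h with h | h
    · exact M.mem_E h.2
    · exact h.2.1.1
  have hSM : ∀ m ∈ S, ∀ w, M.Active m w → ∃ m' ∈ S, (m', w) ∈ M.edges := by
    intro m hm w hw
    obtain ⟨_, w', -, h2, h3⟩ := hS m hm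
    rwa [hw.eq h2]
  refine ⟨ofDominated (symmDiff M.edges C) hE ?_ ?_ ?_, hC, rfl⟩
  · intro m w w' h h'
    rcases (hmem _ _).1 h with h | h <;> rcases (hmem _ _).1 h' with h' | h'
    · exact M.eq_of_mem_left h.2 h'.2
    · exact absurd h'.1 h.1
    · exact absurd h.1 h'.1
    · exact h.2.eq h'.2
  · intro m m' w h h'
    rcases (hmem _ _).1 h with h | h <;> rcases (hmem _ _).1 h' with h' | h'
    · exact M.eq_of_mem_right h.2 h'.2
    · obtain ⟨m1, hm1, h1⟩ := hSM m' h'.1 w h'.2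
      exact absurd (M.eq_of_mem_right h1 h.2 ▸ hm1) h.1
    · obtain ⟨m1, hm1, h1⟩ := hSM m h.1 w h.2
      exact absurd (M.eq_of_mem_right h1 h'.2 ▸ hm1) h'.1
    · exact hinj m h.1 m' h'.1 w h.2 h'.2
  · intro m w h
    by_contra! hc
    have hJ : ∀ m', (m', w) ∈ M.edges → G.rankJ w m < G.rankJ w m' := by
      intro m' hm'
      obtain ⟨m1, h1, h2⟩ := hcov m' w hm'
      exact (hc.2 m1 h1).trans_le h2
    have hn : (m, w) ∉ M.edges := fun hM => (hJ m hM).false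
    obtain ⟨w', hw', hle⟩ : ∃ w', (m, w') ∈ M.edges ∧ G.rankI m w' ≤ G.rankI m w := by
      rcases M.dominated h with h1 | ⟨m', h1, h2⟩
      · exact h1
      · exact absurd (hJ m' h1) h2.not_gt
    by_cases hm : m ∈ S
    · obtain ⟨_, w1, -, h2, -⟩ := hS m hm
      -- An undominated edge at `m ∈ S` would be admissible for `M`, and then the active edge now
      -- matching `m` dominates it.
      have hadm : M.Admissible m w := by
        refine ⟨h, hn, ⟨w', hw', (ltI_iff (M.mem_E hw') h).2 ?_⟩, fun m' hm' =>
          (ltJ_iff h (M.mem_E hm')).2 (hJ m' hm')⟩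
        refine lt_of_le_of_ne hle fun he => hn ?_
        rwa [← rankI_inj (M.mem_E hw') h he]
      exact (hc.1 w1 ((hmem _ _).2 (Or.inr ⟨hm, h2⟩))).not_ge (h2.rankI_le hadm)
    · exact (hc.1 w' ((hmem _ _).2 (Or.inl ⟨hm, hw'⟩))).not_ge hle

/-- The elimination of a rotation in terms of positions: the positions of the vertices in `S`
increase, those of the others do not change, the rotation consists of the old and the new edges at
`S`, and no stable matching separates the vertices in `S` or has one of them strictly between the
old and the new position. -/
theorem Step.exists_support {M M' : G.StableMatching} {C : Set (I × J)} (h : M.Step C M') :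
    ∃ S : Set I, S.Nonempty ∧ (∀ m ∈ S, M.pos m < M'.pos m) ∧ (∀ m ∉ S, M.pos m = M'.pos m) ∧
      (∀ m w, (m, w) ∈ C ↔ m ∈ S ∧ ((m, w) ∈ M.edges ∨ (m, w) ∈ M'.edges)) ∧
      (∀ m ∈ S, ∃ w, (m, w) ∈ M'.edges) ∧
      ∀ L : G.StableMatching, (∀ m ∈ S, L.pos m ≤ M.pos m) ∨ (∀ m ∈ S, M'.pos m ≤ L.pos m) := by
  obtain ⟨hC, hM'⟩ := h
  obtain ⟨S, hne, hCS, hS, hinj, hmin⟩ := hC.exists_support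
  have hmem := mem_symmDiff_iff hCS
  rw [← hM'] at hmem
  have hact : ∀ m ∈ S, ∃ w, M.Active m w ∧ M'.pos m = G.rankI m w := by
    intro m hm
    obtain ⟨_, w, -, h2, -⟩ := hS m hm
    exact ⟨w, h2, M'.pos_eq ((hmem m w).2 (Or.inr ⟨hm, h2⟩))⟩
  refine ⟨S, hne, ?_, ?_, ?_, ?_, ?_⟩
  · intro m hm
    obtain ⟨w, hw, he⟩ := hact m hm
    rw [he]
    exact hw.pos_lt
  · intro m hm
    by_cases hc : ∃ w, (m, w) ∈ M.edges
    · obtain ⟨w, hw⟩ := hc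
      rw [M.pos_eq hw, M'.pos_eq ((hmem m w).2 (Or.inl ⟨hm, hw⟩))]
    · push Not at hc
      rw [M.pos_of_forall_notMem hc, M'.pos_of_forall_notMem fun w hw => ?_]
      rcases (hmem m w).1 hw with h | h
      · exact hc w h.2
      · exact hm h.1
  · intro m w
    rw [hCS, hmem]
    exact ⟨fun ⟨h1, h2⟩ => ⟨h1, h2.imp id fun h => Or.inr ⟨h1, h⟩⟩, fun ⟨h1, h2⟩ =>
      ⟨h1, h2.imp id fun h => h.elim (fun h => absurd h1 h.1) And.right⟩⟩
  · intro m hm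
    obtain ⟨w, hw, -⟩ := hact m hm
    exact ⟨w, (hmem m w).2 (Or.inr ⟨hm, hw⟩)⟩
  · intro L
    -- Passing to the join makes `M ⪯ N`. The vertices of `S` that are worse off in `N` are closed
    -- under successors, so they are none or all of `S`; in the latter case `N`, and so `L`, has
    -- reached the active edges.
    obtain ⟨N, hN⟩ := exists_sup M L
    have hMN : M.Prec N := (prec_iff _ _).2 fun m => by rw [hN]; exact le_max_left _ _
    by_cases hT : ∃ m ∈ S, M.pos m < N.pos m
    · right
      have hTS := hmin {m ∈ S | M.pos m < N.pos m} (fun m hm => hm.1) hT (by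
        rintro m ⟨-, hlt⟩ m' hm' w hw hw'
        obtain ⟨m1, h1, h2⟩ := hMN.exists_next hw hlt
        rw [M.eq_of_mem_right hw' h1] at hm' ⊢
        exact ⟨hm', h2⟩)
      intro m hm
      rw [← hTS] at hm
      obtain ⟨w, hw, he⟩ := hact m hm.1
      have h1 := hMN.rankI_le_pos hw hm.2
      have h2 := hm.2
      rw [hN] at h1 h2
      have h3 := hw.pos_lt
      rw [he]
      omega
    · left
      push Not at hT
      intro m hm
      have := hT m hm
      rw [hN] at this
      omega

end StableMatching

end PrefGraph

/-! ### Lower sets and antichains of a finite order. -/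

/-- An isomorphism onto the lattice of lower sets of a finite partial order induces a bijection onto
the antichains, by taking maximal elements. -/
theorem bijOn_setOf_maximal_of_orderIso {α β : Type*} [PartialOrder α] [PartialOrder β] [Finite β]
    (φ : α ≃o LowerSet β) :
    Set.BijOn (fun a => {b | Maximal (· ∈ φ a) b}) Set.univ {s | IsAntichain (· ≤ ·) s} := by
  refine ⟨fun a _ => setOfPred_maximal_antichain _, ?_, ?_⟩
  · have key : ∀ a b, {x | Maximal (· ∈ φ a) x} = {x | Maximal (· ∈ φ b) x} → φ a ≤ φ b := by
      intro a b h x hx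
      obtain ⟨y, hxy, hy⟩ := (Set.toFinite (φ a : Set β)).exists_le_maximal hx
      have hy' : y ∈ {x | Maximal (· ∈ φ b) x} := h ▸ hy
      exact (φ b).lower hxy hy'.1
    exact fun a _ b _ h => φ.injective ((key a b h).antisymm (key b a h.symm))
  · intro s hs
    refine ⟨φ.symm (lowerClosure s), trivial, ?_⟩
    ext x
    change Maximal (· ∈ φ (φ.symm (lowerClosure s))) x ↔ x ∈ s
    rw [φ.apply_symm_apply]
    exact IsAntichain.maximal_mem_lowerClosure_iff_mem hs

/-! ### Rotations passed by a stable matching. -/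

namespace PrefGraph

variable {I J : Type*} {G : PrefGraph I J}

namespace StableMatching

/-- Every vertex of `I` on the rotation `C` is in `L` at least as badly off as after the elimination
of `C`. -/
def Past (L : G.StableMatching) (C : Set (I × J)) : Prop :=
  ∀ e ∈ C, G.rankI e.1 e.2 ≤ L.pos e.1

variable [Finite I] [Finite J]

theorem Past.mono {M L : G.StableMatching} (h : M.Prec L) {C : Set (I × J)} (hC : M.Past C) :
    L.Past C :=
  fun e he => (hC e he).trans ((prec_iff M L).1 h e.1)

/-- Because a rotation is indivisible, whether it has been passed can be tested at any single vertex
of `S`. -/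
theorem Step.exists_past_iff {M M' : G.StableMatching} {C : Set (I × J)} (h : M.Step C M') :
    ∃ S : Set I, S.Nonempty ∧ (∀ m ∈ S, M.pos m < M'.pos m) ∧ (∀ m ∉ S, M.pos m = M'.pos m) ∧
      (∀ m w, (m, w) ∈ C ↔ m ∈ S ∧ ((m, w) ∈ M.edges ∨ (m, w) ∈ M'.edges)) ∧
      (∀ L : G.StableMatching, L.Past C → ∀ m ∈ S, M'.pos m ≤ L.pos m) ∧
      (∀ L : G.StableMatching, ∀ m ∈ S, M.pos m < L.pos m → L.Past C) := by
  obtain ⟨S, h1, h2, h3, h4, h5, h6⟩ := h.exists_support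
  refine ⟨S, h1, h2, h3, h4, fun L hL m hm => ?_, fun L m hm hlt => ?_⟩
  · obtain ⟨w, hw⟩ := h5 m hm
    rw [M'.pos_eq hw]
    exact hL (m, w) ((h4 m w).2 ⟨hm, Or.inr hw⟩)
  · have hle : ∀ m ∈ S, M'.pos m ≤ L.pos m := (h6 L).resolve_left fun h => (h m hm).not_gt hlt
    rintro ⟨m', w⟩ he
    obtain ⟨hm', he⟩ := (h4 m' w).1 he
    refine le_trans ?_ (hle m' hm')
    rcases he with he | he
    · exact (M.pos_eq he).symm.trans_le (h2 m' hm').le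
    · exact (M'.pos_eq he).symm.le

theorem Step.not_past {M M' : G.StableMatching} {C : Set (I × J)} (h : M.Step C M') :
    ¬ M.Past C := by
  obtain ⟨S, ⟨m, hm⟩, h2, -, -, h5, -⟩ := h.exists_past_iff
  exact fun hC => (h5 M hC m hm).not_gt (h2 m hm)

theorem Step.past {M M' : G.StableMatching} {C : Set (I × J)} (h : M.Step C M') : M'.Past C := by
  obtain ⟨S, ⟨m, hm⟩, h2, -, -, -, h6⟩ := h.exists_past_iff
  exact h6 M' m hm (h2 m hm)

theorem Step.prec {M M' : G.StableMatching} {C : Set (I × J)} (h : M.Step C M') : M.Prec M' := by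
  obtain ⟨S, -, h2, h3, -⟩ := h.exists_past_iff
  refine (prec_iff M M').2 fun m => ?_
  by_cases hm : m ∈ S
  · exact (h2 m hm).le
  · exact (h3 m hm).le

theorem mem_iff_of_pos_eq (M L : G.StableMatching) {m : I} (h : M.pos m = L.pos m) (w : J) :
    (m, w) ∈ M.edges ↔ (m, w) ∈ L.edges := by
  constructor
  · intro hw
    obtain ⟨w', hw'⟩ := covered_left M L hw
    rwa [eq_of_pos_eq M L hw hw' h]
  · intro hw
    obtain ⟨w', hw'⟩ := covered_left L M hw
    rwa [eq_of_pos_eq L M hw hw' h.symm]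

/-- Eliminating the rotation `C` adds exactly `C` to the set of rotations that have been passed. -/
theorem Step.past_iff {M M' N N' : G.StableMatching} {C D : Set (I × J)} (h : M.Step C M')
    (h' : N.Step D N') : M'.Past D ↔ M.Past D ∨ D = C := by
  constructor
  · intro hD
    by_contra! hc
    obtain ⟨S, -, s2, s3, s4, s5, s6⟩ := h.exists_past_iff
    obtain ⟨T, ⟨m0, hm0⟩, t2, t3, t4, t5, t6⟩ := h'.exists_past_iff
    -- On `T` the interval from `N` to `N'` lies within that from `M` to `M'`, so `T ⊆ S`. Then `N`
    -- has not passed `C` but `N'` has, and the reverse inclusions follow. Equal supports and equal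
    -- end positions force `C = D`.
    have hle : ∀ m ∈ T, M.pos m ≤ N.pos m := fun m hm =>
      not_lt.1 fun hlt => hc.1 (t6 M m hm hlt)
    have hle' : ∀ m ∈ T, N'.pos m ≤ M'.pos m := t5 M' hD
    have hTS : T ⊆ S := fun m hm => by
      by_contra hn
      have := s3 m hn
      have := hle m hm
      have := hle' m hm
      have := t2 m hm
      omega
    have hN : ¬ N.Past C := fun hp => by
      have := s5 N hp m0 (hTS hm0)
      have := hle' m0 hm0
      have := t2 m0 hm0
      omega
    have hN' : N'.Past C := s6 N' m0 (hTS hm0) ((hle m0 hm0).trans_lt (t2 m0 hm0))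
    have hge : ∀ m ∈ S, N.pos m ≤ M.pos m := fun m hm =>
      not_lt.1 fun hlt => hN (s6 N m hm hlt)
    have hge' : ∀ m ∈ S, M'.pos m ≤ N'.pos m := s5 N' hN'
    have hST : S ⊆ T := fun m hm => by
      by_contra hn
      have := t3 m hn
      have := hge m hm
      have := hge' m hm
      have := s2 m hm
      omega
    obtain rfl := hST.antisymm hTS
    refine hc.2 (Set.ext ?_)
    rintro ⟨m, w⟩
    rw [s4, t4]
    refine and_congr_right fun hm => ?_
    rw [mem_iff_of_pos_eq M N ((hle m hm).antisymm (hge m hm)),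
      mem_iff_of_pos_eq M' N' ((hge' m hm).antisymm (hle' m hm))]
  · rintro (hD | rfl)
    · exact hD.mono h.prec
    · exact h.past

/-- Any worse stable matching can be approached by eliminating a rotation. -/
theorem Prec.exists_step {M L : G.StableMatching} (h : M.Prec L) (hne : M ≠ L) :
    ∃ C M', M.Step C M' ∧ M'.Prec L ∧ ∀ e ∈ C, M.pos e.1 < L.pos e.1 := by
  obtain ⟨C, hC, hlt⟩ := h.exists_isRotation hne
  obtain ⟨M', hM'⟩ := hC.exists_step
  refine ⟨C, M', hM', (prec_iff _ _).2 fun m => ?_, hlt⟩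
  obtain ⟨S, -, s2, s3, s4, s5, s6⟩ := hM'.exists_past_iff
  by_cases hm : m ∈ S
  · obtain ⟨w, hw⟩ := exists_mem_of_pos_lt (s2 m hm)
    exact s5 L (s6 L m hm (hlt (m, w) ((s4 m w).2 ⟨hm, Or.inr hw⟩))) m hm
  · rw [← s3 m hm]
    exact (prec_iff _ _).1 h m

theorem Prec.reflTransGen {M L : G.StableMatching} (h : M.Prec L) :
    Relation.ReflTransGen (fun M M' : G.StableMatching => ∃ C, M.Step C M') M L := by
  let _ := lattice G
  induction M using WellFoundedGT.induction with
  | ind M ih =>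
    by_cases hne : M = L
    · exact hne ▸ Relation.ReflTransGen.refl
    · obtain ⟨C, M', h1, h2, -⟩ := h.exists_step hne
      have hlt : M < M' := lt_of_le_of_ne h1.prec fun he => h1.not_past (he ▸ h1.past)
      exact Relation.ReflTransGen.head ⟨C, h1⟩ (ih M' hlt h2)

/-! ### Construction of traces. -/

/-- The first `n` members of a sequence of eliminations of rotations lead from `A` to `B`. -/
def IsStepSeq (A B : G.StableMatching) (n : ℕ) (f : ℕ → G.StableMatching)
    (r : ℕ → Set (I × J)) : Prop :=
  f 0 = A ∧ f n = B ∧ ∀ i < n, (f i).Step (r i) (f (i + 1))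

omit [Finite I] [Finite J] in
theorem IsStepSeq.cons {A A' B : G.StableMatching} {n : ℕ} {f : ℕ → G.StableMatching}
    {r : ℕ → Set (I × J)} {C : Set (I × J)} (h : A.Step C A') (hs : IsStepSeq A' B n f r) :
    IsStepSeq A B (n + 1) (fun i => Nat.casesOn i A f) (fun i => Nat.casesOn i C r) := by
  obtain ⟨h1, h2, h3⟩ := hs
  refine ⟨rfl, h2, fun i hi => ?_⟩
  cases i with
  | zero =>
    change A.Step C (f 0)
    rwa [h1]
  | succ i => exact h3 i (by omega)

-- The shift by `k` records where the old sequence sits in the longer one; it locates a prescribed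
-- matching or rotation on a trace.
omit [Finite I] [Finite J] in
theorem IsStepSeq.extend {A A' B : G.StableMatching} {n : ℕ} {f : ℕ → G.StableMatching}
    {r : ℕ → Set (I × J)}
    (h : Relation.ReflTransGen (fun M M' : G.StableMatching => ∃ C, M.Step C M') A A')
    (hs : IsStepSeq A' B n f r) :
    ∃ k f' r', IsStepSeq A B (n + k) f' r' ∧ ∀ i, f' (i + k) = f i ∧ r' (i + k) = r i := by
  induction h using Relation.ReflTransGen.head_induction_on with
  | refl => exact ⟨0, f, r, hs, fun i => ⟨rfl, rfl⟩⟩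
  | head h _ ih =>
    obtain ⟨C, hC⟩ := h
    obtain ⟨k, f', r', h1, h2⟩ := ih
    exact ⟨k + 1, _, _, h1.cons hC, fun i => h2 i⟩

theorem exists_isStepSeq {A B : G.StableMatching} (h : A.Prec B) :
    ∃ n f r, IsStepSeq A B n f r := by
  obtain ⟨k, f, r, h1, -⟩ := IsStepSeq.extend (n := 0) (f := fun _ => B) (r := fun _ => ∅)
    h.reflTransGen ⟨rfl, rfl, fun i hi => absurd hi (Nat.not_lt_zero i)⟩
  exact ⟨_, f, r, h1⟩

/-- The trace given by a sequence of eliminations of rotations. -/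
def IsStepSeq.toTrace {A B : G.StableMatching} {n : ℕ} {f : ℕ → G.StableMatching}
    {r : ℕ → Set (I × J)} (h : IsStepSeq A B n f r) (hA : A.IsMmin) (hB : B.IsMmax) : G.Trace where
  len := n
  matching i := f i
  rot i := r i
  first := h.1.symm ▸ hA
  last := h.2.1.symm ▸ hB
  isRotation i := (h.2.2 i i.2).1
  step i := (h.2.2 i i.2).2

/-- Every stable matching lies on a trace. -/
theorem exists_trace (M : G.StableMatching) :
    ∃ (τ : G.Trace) (i : Fin (τ.len + 1)), τ.matching i = M := by
  obtain ⟨A, hA⟩ := exists_isMmin (G := G)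
  obtain ⟨B, hB⟩ := exists_isMmax (G := G)
  obtain ⟨n, f, r, h⟩ := exists_isStepSeq (hB M).2
  obtain ⟨k, f', r', h', hk⟩ := h.extend (hA M).1.reflTransGen
  refine ⟨h'.toTrace hA hB, ⟨0 + k, ?_⟩, (hk 0).1.trans h.1⟩
  change 0 + k < n + k + 1
  omega

/-- Every elimination of a rotation occurs on a trace. -/
theorem Step.exists_rotation {M M' : G.StableMatching} {C : Set (I × J)} (hC : M.Step C M') :
    ∃ R : G.Rotation, R.edges = C := by
  obtain ⟨A, hA⟩ := exists_isMmin (G := G)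
  obtain ⟨B, hB⟩ := exists_isMmax (G := G)
  obtain ⟨n, f, r, h⟩ := exists_isStepSeq (hB M').2
  obtain ⟨k, f', r', h', hk⟩ := (h.cons hC).extend (hA M).1.reflTransGen
  refine ⟨⟨C, h'.toTrace hA hB, ⟨0 + k, ?_⟩, (hk 0).2⟩, rfl⟩
  change 0 + k < n + 1 + k
  omega

end StableMatching

/-! ### Traces and the rotation poset. -/

open StableMatching

theorem Rotation.ext_edges {C D : G.Rotation} (h : C.edges = D.edges) : C = D := by
  cases C
  cases D
  cases h
  rfl

theorem Trace.step_at (τ : G.Trace) (i : Fin τ.len) :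
    (τ.matching i.castSucc).Step (τ.rot i) (τ.matching i.succ) :=
  ⟨τ.isRotation i, τ.step i⟩

theorem Rotation.exists_step (C : G.Rotation) :
    ∃ M M' : G.StableMatching, M.Step C.edges M' := by
  obtain ⟨τ, i, h⟩ := C.occurs
  exact ⟨_, _, h ▸ τ.step_at i⟩

instance [Finite I] [Finite J] : Finite G.Rotation :=
  Finite.of_injective Rotation.edges fun _ _ => Rotation.ext_edges

variable [Finite I] [Finite J]

theorem StableMatching.IsMmin.not_past {M : G.StableMatching} (h : M.IsMmin) (C : G.Rotation) :
    ¬ M.Past C.edges := by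
  obtain ⟨N, N', hN⟩ := C.exists_step
  exact fun hC => hN.not_past (hC.mono (h N).1)

theorem StableMatching.IsMmax.past {M : G.StableMatching} (h : M.IsMmax) (C : G.Rotation) :
    M.Past C.edges := by
  obtain ⟨N, N', hN⟩ := C.exists_step
  exact hN.past.mono (h N').2

/-- Induction along the trace by `Step.past_iff`. The right-hand side depends on the matching only,
whence the independence of the trace. -/
theorem Trace.rotationsBefore_eq (τ : G.Trace) (i : Fin (τ.len + 1)) :
    τ.rotationsBefore i = {C : G.Rotation | (τ.matching i).Past C.edges} := by
  induction i using Fin.induction with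
  | zero =>
    ext C
    refine ⟨?_, fun h => absurd h (τ.first.not_past C)⟩
    rintro ⟨j, hj, -⟩
    exact absurd hj (Fin.not_lt_zero _)
  | succ i ih =>
    ext C
    obtain ⟨N, N', hN⟩ := C.exists_step
    have h1 : C ∈ τ.rotationsBefore i.castSucc ↔ (τ.matching i.castSucc).Past C.edges := by
      rw [ih]
      rfl
    refine Iff.trans ?_ ((τ.step_at i).past_iff hN).symm
    rw [← h1]
    constructor
    · rintro ⟨j, hj, he⟩
      rcases (Fin.castSucc_lt_succ_iff.1 hj).eq_or_lt with rfl | hlt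
      · exact Or.inr he.symm
      · exact Or.inl ⟨j, Fin.castSucc_lt_castSucc_iff.2 hlt, he⟩
    · rintro (⟨j, hj, he⟩ | he)
      · exact ⟨j, hj.trans Fin.castSucc_lt_succ, he⟩
      · exact ⟨i, Fin.castSucc_lt_succ, he.symm⟩

theorem Trace.past_iff (τ : G.Trace) (i : Fin (τ.len + 1)) (C : G.Rotation) :
    (τ.matching i).Past C.edges ↔ ∃ j : Fin τ.len, j.castSucc < i ∧ τ.rot j = C.edges := by
  have h := Set.ext_iff.1 (τ.rotationsBefore_eq i) C
  exact h.symm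

theorem StableMatching.rotations_eq (M : G.StableMatching) :
    M.rotations = {C : G.Rotation | M.Past C.edges} := by
  ext C
  constructor
  · rintro ⟨τ, i, rfl, h⟩
    rwa [τ.rotationsBefore_eq] at h
  · intro h
    obtain ⟨τ, i, rfl⟩ := exists_trace M
    refine ⟨τ, i, rfl, ?_⟩
    rwa [τ.rotationsBefore_eq]

theorem Trace.exists_rot_eq (τ : G.Trace) (C : G.Rotation) :
    ∃ j : Fin τ.len, τ.rot j = C.edges := by
  obtain ⟨j, -, h⟩ := (τ.past_iff (Fin.last _) C).1 (τ.last.past C)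
  exact ⟨j, h⟩

/-- A repeated rotation would already have been passed at its second elimination. -/
theorem Trace.rot_injective (τ : G.Trace) : Function.Injective τ.rot := by
  have key : ∀ i j, τ.rot i = τ.rot j → ¬ i < j := fun i j h hlt =>
    (τ.step_at j).not_past ((τ.past_iff j.castSucc ⟨τ.rot j, τ, j, rfl⟩).2
      ⟨i, Fin.castSucc_lt_castSucc_iff.2 hlt, h⟩)
  exact fun i j h => le_antisymm (not_lt.1 (key j i h.symm)) (not_lt.1 (key i j h))

/-- The rotation poset: `C ≤ D` if every stable matching that has passed `D` has passed `C`. -/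
abbrev Rotation.partialOrder (G : PrefGraph I J) : PartialOrder G.Rotation where
  le C D := ∀ M : G.StableMatching, M.Past D.edges → M.Past C.edges
  le_refl _ _ h := h
  le_trans _ _ _ h h' M hM := h M (h' M hM)
  le_antisymm C D h h' := by
    obtain ⟨N, N', hN⟩ := C.exists_step
    obtain ⟨L, L', hL⟩ := D.exists_step
    -- Eliminating `C` from `N` passes `D` too; as only `C` is newly passed, and `N` had not passed
    -- `D`, they coincide.
    rcases (hN.past_iff hL).1 (h' N' hN.past) with h1 | h1
    · exact absurd (h N h1) hN.not_past
    · exact Rotation.ext_edges h1.symm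

theorem Rotation.lt_iff_precedes (C D : G.Rotation) :
    (Rotation.partialOrder G).lt C D ↔ C.Precedes D := by
  let _ := Rotation.partialOrder G
  change C < D ↔ _
  constructor
  · intro h τ
    obtain ⟨j, hj⟩ := τ.exists_rot_eq D
    obtain ⟨i, hi, hi'⟩ := (τ.past_iff j.succ C).1
      (h.le _ ((τ.past_iff j.succ D).2 ⟨j, Fin.castSucc_lt_succ, hj⟩))
    refine ⟨i, j, lt_of_le_of_ne (Fin.castSucc_lt_succ_iff.1 hi) ?_, hi', hj⟩
    rintro rfl
    exact h.ne (Rotation.ext_edges (hi'.symm.trans hj))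
  · intro h
    refine lt_of_le_of_ne (fun M hM => ?_) ?_
    · obtain ⟨τ, k, rfl⟩ := exists_trace M
      obtain ⟨j', hj', h1⟩ := (τ.past_iff k D).1 hM
      obtain ⟨i, j, hij, hi, hj⟩ := h τ
      obtain rfl := τ.rot_injective (hj.trans h1.symm)
      exact (τ.past_iff k C).2 ⟨i, (Fin.castSucc_lt_castSucc_iff.2 hij).trans hj', hi⟩
    · rintro rfl
      obtain ⟨τ, -⟩ := C.occurs
      obtain ⟨i, j, hij, hi, hj⟩ := h τ
      exact hij.ne (τ.rot_injective (hi.trans hj.symm))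

/-! ### Stable matchings as ideals of rotations. -/

namespace StableMatching

theorem prec_iff_past (M L : G.StableMatching) :
    M.Prec L ↔ ∀ C : G.Rotation, M.Past C.edges → L.Past C.edges := by
  refine ⟨fun h C hC => hC.mono h, fun h => ?_⟩
  obtain ⟨N, hN⟩ := exists_sup M L
  have hLN : L.Prec N := (prec_iff _ _).2 fun m => by rw [hN]; exact le_max_right _ _
  by_contra hc
  have hne : L ≠ N := fun he => hc ((prec_iff _ _).2 fun m => by
    rw [he, hN]; exact le_max_left _ _)
  -- This rotation leads from `L` towards the join `N`. At its vertices `N` is beyond `L`, so there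
  -- `N` has the position of `M`; thus `M` has passed it and `L` has not.
  obtain ⟨C, L', hs, -, hlt⟩ := hLN.exists_step hne
  obtain ⟨R, rfl⟩ := hs.exists_rotation
  obtain ⟨S, ⟨m, hm⟩, s2, -, s4, -, s6⟩ := hs.exists_past_iff
  obtain ⟨w, hw⟩ := exists_mem_of_pos_lt (s2 m hm)
  have h1 : L.pos m < N.pos m := hlt (m, w) ((s4 m w).2 ⟨hm, Or.inr hw⟩)
  rw [hN] at h1
  exact hs.not_past (h R (s6 M m hm (by omega)))

theorem exists_past_iff_or (M L : G.StableMatching) : ∃ N : G.StableMatching,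
    ∀ C : G.Rotation, N.Past C.edges ↔ M.Past C.edges ∨ L.Past C.edges := by
  obtain ⟨N, hN⟩ := exists_sup M L
  refine ⟨N, fun C => ⟨fun h => ?_, ?_⟩⟩
  · obtain ⟨K, K', hK⟩ := C.exists_step
    obtain ⟨S, ⟨m, hm⟩, s2, -, -, s5, s6⟩ := hK.exists_past_iff
    have h1 := s5 N h m hm
    have h2 := s2 m hm
    rw [hN] at h1
    -- The maximum at the single vertex `m` is attained by `M` or by `L`, and one vertex decides.
    by_cases hc : K.pos m < M.pos m
    · exact Or.inl (s6 M m hm hc)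
    · exact Or.inr (s6 L m hm (by omega))
  · rintro (h | h)
    · exact h.mono ((prec_iff _ _).2 fun m => by rw [hN]; exact le_max_left _ _)
    · exact h.mono ((prec_iff _ _).2 fun m => by rw [hN]; exact le_max_right _ _)

theorem exists_past_iff_and (M L : G.StableMatching) : ∃ N : G.StableMatching,
    ∀ C : G.Rotation, N.Past C.edges ↔ M.Past C.edges ∧ L.Past C.edges := by
  obtain ⟨N, hN⟩ := exists_inf M L
  refine ⟨N, fun C => ⟨fun h => ⟨?_, ?_⟩, fun h e he => ?_⟩⟩
  · exact h.mono ((prec_iff _ _).2 fun m => by rw [hN]; exact min_le_left _ _)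
  · exact h.mono ((prec_iff _ _).2 fun m => by rw [hN]; exact min_le_right _ _)
  · rw [hN]
    exact le_min (h.1 e he) (h.2 e he)

/-- For every rotation `D` there is a stable matching that has passed exactly the rotations up
to `D`. -/
theorem exists_past_iff_le (D : G.Rotation) : ∃ N : G.StableMatching,
    ∀ C : G.Rotation, N.Past C.edges ↔ (Rotation.partialOrder G).le C D := by
  obtain ⟨K, K', hK⟩ := D.exists_step
  -- With the fewest rotations passed, `N` loses none of them when met with any `M` past `D`; so
  -- each is passed by every such `M`.
  obtain ⟨N, hN, hmin⟩ := Set.exists_min_image {N : G.StableMatching | N.Past D.edges}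
    (fun N => {C : G.Rotation | N.Past C.edges}.ncard) (Set.toFinite _) ⟨K', hK.past⟩
  refine ⟨N, fun C => ⟨fun hC M hM => ?_, fun h => h N hN⟩⟩
  obtain ⟨L, hL⟩ := exists_past_iff_and N M
  have h1 := Set.eq_of_subset_of_ncard_le
    (show {C : G.Rotation | L.Past C.edges} ⊆ {C | N.Past C.edges} from
      fun C hC => ((hL C).1 hC).1) (hmin L ((hL D).2 ⟨hN, hM⟩)) (Set.toFinite _)
  have h2 : L.Past C.edges := h1.symm.subset hC
  exact ((hL C).1 h2).2

/-- Every ideal of rotations is the set of the rotations passed by a stable matching. -/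
theorem exists_past_iff_mem (S : Set G.Rotation)
    (hS : ∀ C D, (Rotation.partialOrder G).le C D → D ∈ S → C ∈ S) :
    ∃ N : G.StableMatching, ∀ C : G.Rotation, N.Past C.edges ↔ C ∈ S := by
  obtain ⟨A, hA⟩ := exists_isMmin (G := G)
  -- A matching passing as many rotations as possible within `S` absorbs the principal ideal of
  -- every `D ∈ S`, since joining it stays within `S`.
  obtain ⟨N, hN, hmax⟩ := Set.exists_max_image
    {N : G.StableMatching | ∀ C : G.Rotation, N.Past C.edges → C ∈ S}
    (fun N => {C : G.Rotation | N.Past C.edges}.ncard) (Set.toFinite _)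
    ⟨A, fun C hC => absurd hC (hA.not_past C)⟩
  refine ⟨N, fun D => ⟨hN D, fun hD => ?_⟩⟩
  obtain ⟨K, hK⟩ := exists_past_iff_le D
  obtain ⟨L, hL⟩ := exists_past_iff_or N K
  have h1 := Set.eq_of_subset_of_ncard_le
    (show {C : G.Rotation | N.Past C.edges} ⊆ {C | L.Past C.edges} from
      fun C hC => (hL C).2 (Or.inl hC))
    (hmax L fun C hC => ((hL C).1 hC).elim (hN C) fun h => hS C D ((hK C).1 h) hD)
    (Set.toFinite _)
  exact h1.symm.subset ((hL D).2 (Or.inr ((hK D).2 fun _ h => h)))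

end StableMatching

end PrefGraph

open PrefGraph StableMatching in
theorem mainTheorem3 {I J : Type*} [Finite I] [Finite J] (G : PrefGraph I J) :
    -- every stable matching lies on a trace, and neither the set of all rotations of a trace nor
    -- the set of those used up to a given matching depends on the trace
    (∀ M : G.StableMatching, ∃ (τ : G.Trace) (i : Fin (τ.len + 1)), τ.matching i = M) ∧
    (∀ (τ : G.Trace) (i : Fin (τ.len + 1)), τ.rotationsBefore i = (τ.matching i).rotations) ∧
    (∀ (τ : G.Trace) (C : G.Rotation), ∃ j : Fin τ.len, τ.rot j = C.edges) ∧
    -- the stable matchings form a lattice under `⪯`, the rotations a poset under `⋖`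
    ∃ (_ : Lattice G.StableMatching) (_ : PartialOrder G.Rotation),
      (∀ M L : G.StableMatching, M ≤ L ↔ M.Prec L) ∧
      (∀ C D : G.Rotation, C < D ↔ C.Precedes D) ∧
      -- `M ↦ R_M` is a lattice isomorphism onto the ideals of the rotation poset
      (∃ φ : G.StableMatching ≃o LowerSet G.Rotation,
        (∀ M, (φ M : Set G.Rotation) = M.rotations) ∧
        (∀ M L, φ (M ⊔ L) = φ M ⊔ φ L) ∧ (∀ M L, φ (M ⊓ L) = φ M ⊓ φ L)) ∧
      -- taking the maximal elements of `R_M` is a bijection onto the antichains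
      Set.BijOn (fun M : G.StableMatching => {C : G.Rotation | Maximal (· ∈ M.rotations) C})
        Set.univ {S : Set G.Rotation | IsAntichain (· ≤ ·) S} := by
  refine ⟨exists_trace, fun τ i => ?_, Trace.exists_rot_eq, lattice G, Rotation.partialOrder G,
    fun _ _ => Iff.rfl, Rotation.lt_iff_precedes, ?_⟩
  · rw [rotations_eq, Trace.rotationsBefore_eq]
  let _ := lattice G
  let _ := Rotation.partialOrder G
  let e : G.StableMatching ↪o LowerSet G.Rotation := OrderEmbedding.ofMapLEIff
    (fun M => ⟨{C | M.Past C.edges}, fun _ _ h hC => h M hC⟩)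
    (fun M L => (prec_iff_past M L).symm)
  have he : Function.Surjective e := by
    intro S
    obtain ⟨N, hN⟩ := exists_past_iff_mem (S : Set G.Rotation) fun C D h hD => S.lower h hD
    exact ⟨N, LowerSet.ext (Set.ext hN)⟩
  let φ : G.StableMatching ≃o LowerSet G.Rotation := RelIso.ofSurjective e he
  have hφ : ∀ M, (φ M : Set G.Rotation) = M.rotations := fun M => (rotations_eq M).symm
  refine ⟨⟨φ, hφ, map_sup φ, map_inf φ⟩, ?_⟩
  have h := bijOn_setOf_maximal_of_orderIso φ
  have hf : (fun M : G.StableMatching => {C : G.Rotation | Maximal (· ∈ M.rotations) C}) =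
      fun M => {C | Maximal (· ∈ φ M) C} := by
    funext M
    rw [← hφ M]
    rfl
  rw [hf]
  exact h
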